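/- Let $R$ be a commutative ring, $Q\in R[y]$, and $(A_i,\alpha_i,r_i)\in R[y]\times R\times R$ for $1\le i\le \ell$, with every $A_i$ monic, $\delta_i=\deg A_i$, $A_i=\sum_{0\le j\le\delta_i}a_{i,j}y^j$. For $B$ monic, $F \operatorname{rem} B$ denotes the remainder of the division of $F$ by $B$. Algorithm ShiftedRem computes, for all $i$, 1. $\bar A_i=\sum_{0\le j\le \delta_i} r_i^{\delta_i-j}a_{i,j}\,y^j$; 2. $\hat A_i=\bar A_i(y-\alpha_i)$; 3. $\hat R_i=Q \operatorname{rem} \hat A_i$; 4. $R_i=\hat R_i(\alpha_i+r_iy)$; and returns $(R_1,\dots,R_\ell)$. **Proposition.** (Correctness.) The algorithm returns the shifted remainders: $R_i=Q(\alpha_i+r_iy)\operatorname{rem}A_i$ for all $1\le i\le \ell$. (Cost.) The algorithm can be carried out with $\tilde O\big(\deg Q+\deg(A_1\cdots A_\ell)\big)$ operations in $R$. Precisely: there are constants $c,k\in\mathbb N$ and, for all $n,\ell,\delta_1,\dots,\delta_\ell\in\mathbb N$, four straight-line programs, one for each of the lines 1–4, whose instructions are additions, subtractions and multiplications of constants $0,1$,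 inputs and earlier results, such that for every commutative ring $R$ and all $Q,A_i,\alpha_i,r_i$ as above the programs for $n=\deg Q$, $\ell$ and $\delta_i=\deg A_i$ do the following. Executed one after the other on the coefficients of $Q,A_1,\dots,A_\ell$ and on the $\alpha_i,r_i$, each of them reading only the input and the output of the line before, they output the coefficients of the $\bar A_i$, of the $\hat A_i$, of the $\hat R_i$ and of the $R_i$, respectively; and their total number of instructions is at most $c\,N\,\lfloor\log_2(N+2)\rfloor^k$, where $N=\deg Q+\deg(A_1\cdots A_\ell)$ (the degree of the zero polynomial being counted as $0$). -/

import Mathlib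

open Polynomial

/-! ### Straight-line programs over a commutative ring -/

/-- The three operations of a ring that are counted. -/
inductive RingOp : Type
  | add
  | sub
  | mul

/-- The value of a ring operation in the ring `R`. -/
def RingOp.apply {R : Type*} [CommRing R] : RingOp → R → R → R
  | RingOp.add, a, b => a + b
  | RingOp.sub, a, b => a - b
  | RingOp.mul, a, b => a * b

/-- What an instruction can read: one of the constants `0` and `1`, one of the inputs (indexed
by `ι`), or the result of an earlier instruction (instructions are numbered from `0`). -/
inductive Operand (ι : Type) : Type
  | zero : Operand ι
  | one : Operand ι
  | input : ι → Operand ι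
  | reg : ℕ → Operand ι

/-- The value of an operand, given the inputs `x` and the list `m` of the results of the
instructions executed so far. (A register that has not been written yet reads `0`.) -/
def Operand.val {R : Type*} [CommRing R] {ι : Type} (x : ι → R) (m : List R) : Operand ι → R
  | Operand.zero => 0
  | Operand.one => 1
  | Operand.input i => x i
  | Operand.reg j => m.getD j 0

/-- One instruction: exactly one ring operation, applied to two operands. -/
structure Instr (ι : Type) : Type where
  op : RingOp
  lhs : Operand ι
  rhs : Operand ι

/-- Execution of a list of instructions on the inputs `x`, started with the earlier results `m`;
each instruction appends its result. -/
def execInstrs {R : Type*} [CommRing R] {ι : Type} (x : ι → R) :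
    List (Instr ι) → List R → List R
  | [], m => m
  | c :: cs, m => execInstrs x cs (m ++ [c.op.apply (c.lhs.val x m) (c.rhs.val x m)])

/-- A straight-line program with inputs indexed by `ι` and outputs indexed by `κ`. It does not
mention a ring, so the same program can be executed over every commutative ring. -/
structure StraightLineProgram (ι κ : Type) : Type where
  code : List (Instr ι)
  out : κ → Operand ι

/-- The number of ring operations that the program executes (over whichever ring). -/
def StraightLineProgram.cost {ι κ : Type} (P : StraightLineProgram ι κ) : ℕ := P.code.length

/-- The outputs of the program on the inputs `x` in the ring `R`. -/
def StraightLineProgram.eval {R : Type*} [CommRing R] {ι κ : Type}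
    (P : StraightLineProgram ι κ) (x : ι → R) : κ → R :=
  fun k => (P.out k).val x (execInstrs x P.code [])

/-! ### The algorithm `ShiftedRem` -/

section Algorithm

variable {R : Type*} [CommRing R]

/-- Line 1, for one index: from `A = ∑ j ≤ δ, a j * y ^ j` with `a δ = 1` to
`∑ j ≤ δ, r ^ (δ - j) * a j * y ^ j`. -/
noncomputable def scaledModulus (A : R[X]) (r : R) : R[X] :=
  ∑ j ∈ Finset.range (A.natDegree + 1), C (r ^ (A.natDegree - j) * A.coeff j) * X ^ j

/-- Line 2, for one index: substitute `y - α` for `y` in the result of line 1. -/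
noncomputable def shiftedModulus (A : R[X]) (α r : R) : R[X] :=
  (scaledModulus A r).comp (X - C α)

/-- Line 3, for one index: the remainder of `Q` modulo the result of line 2. -/
noncomputable def shiftedModulusRem (Q A : R[X]) (α r : R) : R[X] :=
  Q %ₘ shiftedModulus A α r

/-- The algorithm `ShiftedRem`; line 4 substitutes `α i + r i * y` for `y` in the result of
line 3, and the family of these polynomials is returned. -/
noncomputable def shiftedRem {l : ℕ} (Q : R[X]) (A : Fin l → R[X]) (α r : Fin l → R) :
    Fin l → R[X] :=
  fun i => (shiftedModulusRem Q (A i) (α i) (r i)).comp (C (α i) + C (r i) * X)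

/-- The polynomial with coefficient vector `v`. -/
noncomputable def polyOfCoeffs {m : ℕ} (v : Fin m → R) : R[X] := ∑ j : Fin m, C (v j) * X ^ (j : ℕ)

end Algorithm

/-! ### Implementations of the algorithm by straight-line programs -/

/-- Positions of the coefficients of a family of polynomials of degrees `δ i`. -/
abbrev CoeffIndex {l : ℕ} (δ : Fin l → ℕ) : Type := (i : Fin l) × Fin (δ i + 1)

/-- Positions of the coefficients of a family of polynomials of degrees less than `δ i`. -/
abbrev RemIndex {l : ℕ} (δ : Fin l → ℕ) : Type := (i : Fin l) × Fin (δ i)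

/-- Straight-line programs for the four lines of `ShiftedRem`, for inputs `Q` of degree `n` and
`A i` of degrees `δ i`; all polynomials are given by their coefficients.
* `line1` reads the `A i` and the `r i`;
* `line2` reads the result of line 1 and the `α i`;
* `line3` reads `Q` and the result of line 2;
* `line4` reads the result of line 3, the `α i` and the `r i`. -/
structure ShiftedRemProgram (n : ℕ) {l : ℕ} (δ : Fin l → ℕ) : Type where
  line1 : StraightLineProgram (CoeffIndex δ ⊕ Fin l) (CoeffIndex δ)
  line2 : StraightLineProgram (CoeffIndex δ ⊕ Fin l) (CoeffIndex δ)
  line3 : StraightLineProgram (Fin (n + 1) ⊕ CoeffIndex δ) (RemIndex δ)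
  line4 : StraightLineProgram (RemIndex δ ⊕ (Fin l ⊕ Fin l)) (RemIndex δ)

namespace ShiftedRemProgram

variable {R : Type*} [CommRing R] {n l : ℕ} {δ : Fin l → ℕ}

/-- The total number of ring operations. -/
def cost (P : ShiftedRemProgram n δ) : ℕ :=
  P.line1.cost + P.line2.cost + P.line3.cost + P.line4.cost

/-- The result of line 1, on the coefficients `a` of the `A i`. -/
def result1 (P : ShiftedRemProgram n δ) (a : CoeffIndex δ → R) (r : Fin l → R) :
    CoeffIndex δ → R :=
  P.line1.eval (Sum.elim a r)

/-- The result of lines 1 and 2. -/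
def result2 (P : ShiftedRemProgram n δ) (a : CoeffIndex δ → R) (α r : Fin l → R) :
    CoeffIndex δ → R :=
  P.line2.eval (Sum.elim (P.result1 a r) α)

/-- The result of lines 1 to 3, where `q` are the coefficients of `Q`. -/
def result3 (P : ShiftedRemProgram n δ) (q : Fin (n + 1) → R) (a : CoeffIndex δ → R)
    (α r : Fin l → R) : RemIndex δ → R :=
  P.line3.eval (Sum.elim q (P.result2 a α r))

/-- The result of lines 1 to 4. -/
def result4 (P : ShiftedRemProgram n δ) (q : Fin (n + 1) → R) (a : CoeffIndex δ → R)
    (α r : Fin l → R) : RemIndex δ → R :=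
  P.line4.eval (Sum.elim (P.result3 q a α r) (Sum.elim α r))

end ShiftedRemProgram

/-- `P` carries out `ShiftedRem` line by line on the input `Q`, `A`, `α`, `r`: executed on the
coefficients of the input, each line produces the coefficients of the polynomials that this line
of the algorithm computes. -/
structure ShiftedRemProgram.Implements {R : Type*} [CommRing R] {l : ℕ} (Q : R[X])
    (A : Fin l → R[X]) (α r : Fin l → R)
    (P : ShiftedRemProgram Q.natDegree (fun i => (A i).natDegree)) : Prop where
  line1 : ∀ i, polyOfCoeffs (fun j => P.result1 (fun s => (A s.1).coeff s.2) r ⟨i, j⟩) =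
    scaledModulus (A i) (r i)
  line2 : ∀ i, polyOfCoeffs (fun j => P.result2 (fun s => (A s.1).coeff s.2) α r ⟨i, j⟩) =
    shiftedModulus (A i) (α i) (r i)
  line3 : ∀ i, polyOfCoeffs (fun j =>
      P.result3 (fun t => Q.coeff t) (fun s => (A s.1).coeff s.2) α r ⟨i, j⟩) =
    shiftedModulusRem Q (A i) (α i) (r i)
  line4 : ∀ i, polyOfCoeffs (fun j =>
      P.result4 (fun t => Q.coeff t) (fun s => (A s.1).coeff s.2) α r ⟨i, j⟩) =
    shiftedRem Q A α r i

/-!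
Correctness: substituting `α + r * y` into the modified modulus gives `r ^ δ * A`
(`shiftedModulus_comp_affine`). Hence the same substitution turns the division of `Q` by the
modified modulus into a division with remainder of `Q (α + r * y)` by `A`, since it does not raise
the degree of the remainder (`shiftedRem_eq`).

Cost: straight-line programs are replaced by the relation `Computes S n T` between sets of elements
of one ring. A computation with the variables of a polynomial ring over `ℤ` as inputs is a
straight-line program, and evaluating the variables shows that this program does the same over every
commutative ring (`exists_program`). So it is enough to bound the number of operations over a fixed
ring, and results that are shared or permuted cost nothing.

Everything then rests on quasi-linear multiplication of polynomials over a ring in which no integer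
need be invertible (`exists_computes_mul`). For a prime `p`, the polynomials are cut into about `√n`
blocks, which become the coefficients of two polynomials in a new variable. The product of these is
found by evaluation and interpolation at the powers of `x` in `K[x]/(x ^ q - 1)`, with `q` a power
of `p` of order `√n`. The fast Fourier transform there costs only additions (`Computes.dft`). The
inverse transform returns `q` times the product, but only after multiplication by `1 - x ^ (q / p)`,
which makes the orthogonality relations hold (`one_sub_root_mul_sum`); as the blocks are short, they
can still be read off (`coeff_one_sub_root_mul_toCyclic`). The `q` products of values are found
recursively (`ScaledMul.computes_mul`), and the depth of this recursion is doubly logarithmic. The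
result is `2 ^ a` times the product for `p = 2` and `3 ^ b` times the product for `p = 3`, and a
Bézout relation gives the product itself (`ScaledMul.computes_mul_of_two_three`).

With multiplication at hand, Taylor shifts are done by divide and conquer
(`MulBound.computes_taylor`), division by a monic polynomial by Newton inversion of its reversal
(`MulBound.computes_modByMonic`), and the remainders modulo all moduli by descending a tree of
products (`MulBound.computes_remainders`). Each of these adds at most two further logarithmic
factors. Indices with `A i` constant must cost nothing, as the bound vanishes if `Q` and all `A i`
are constant.
-/

/-! ### Counting ring operations without programs -/

/-- `Computes S n T`: starting from the elements of `S` and the constants `0` and `1`, all elements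
of `T` can be obtained with at most `n` ring operations, every intermediate result being reusable
for free. -/
inductive Computes {K : Type*} [CommRing K] : Set K → ℕ → Set K → Prop
  | subset {S T : Set K} {n : ℕ} (h : T ⊆ S ∪ {0, 1}) : Computes S n T
  | step {S T : Set K} {n : ℕ} (op : RingOp) {a b : K} (ha : a ∈ S ∪ {0, 1})
      (hb : b ∈ S ∪ {0, 1}) (h : Computes (insert (op.apply a b) S) n T) : Computes S (n + 1) T

namespace Computes

variable {K : Type*} [CommRing K] {S S' T T' U : Set K} {n m : ℕ}

theorem mono_left (h : Computes S n T) (hS : S ⊆ S' ∪ {0, 1}) : Computes S' n T := by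
  induction h generalizing S' with
  | subset h =>
    refine .subset fun x hx => ?_
    rcases h hx with h | h
    · exact hS h
    · exact Or.inr h
  | @step S T n op a b ha hb h ih =>
    refine .step op (a := a) (b := b) ?_ ?_ (ih ?_)
    · rcases ha with h | h
      exacts [hS h, Or.inr h]
    · rcases hb with h | h
      exacts [hS h, Or.inr h]
    · rintro x (rfl | hx)
      · exact Or.inl (Or.inl rfl)
      · rcases hS hx with h | h
        exacts [Or.inl (Or.inr h), Or.inr h]

theorem mono_right (h : Computes S n T) (hT : T' ⊆ T ∪ {0, 1}) : Computes S n T' := by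
  induction h with
  | subset h =>
    refine .subset fun x hx => ?_
    rcases hT hx with h' | h'
    exacts [h h', Or.inr h']
  | step op ha hb h ih => exact .step op ha hb (ih hT)

theorem mono_cost (h : Computes S n T) (hnm : n ≤ m) : Computes S m T := by
  induction h generalizing m with
  | subset h => exact .subset h
  | step op ha hb h ih =>
    obtain ⟨m, rfl⟩ : ∃ k, m = k + 1 := ⟨m - 1, by omega⟩
    exact .step op ha hb (ih (by omega))

theorem trans (h : Computes S n T) (h' : Computes (S ∪ T) m U) : Computes S (n + m) U := by
  induction h with
  | subset h =>
    refine (h'.mono_left ?_).mono_cost (Nat.le_add_left _ _)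
    exact Set.union_subset Set.subset_union_left h
  | @step S T n op a b ha hb h ih =>
    rw [Nat.add_right_comm]
    refine .step op ha hb (ih (h'.mono_left ?_))
    exact (Set.union_subset_union_left _ (Set.subset_insert _ _)).trans Set.subset_union_left

/-- Sequential composition in which the second stage reads only what `S` and the first stage
provide. -/
theorem trans' (h : Computes S n T) (h' : Computes S' m U) (hS : S' ⊆ S ∪ T ∪ {0, 1}) :
    Computes S (n + m) U :=
  h.trans (h'.mono_left hS)

theorem refl (S : Set K) : Computes S n S := .subset Set.subset_union_left

theorem of_subset (h : T ⊆ S) : Computes S n T := .subset (h.trans Set.subset_union_left)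

theorem union (h : Computes S n T) (h' : Computes S m U) : Computes S (n + m) (T ∪ U) := by
  have h1 : Computes (S ∪ T) m (S ∪ T ∪ U) := by
    have h2 : Computes (S ∪ T) m U := h'.mono_left (by
      intro x hx; exact Or.inl (Or.inl hx))
    clear h h'
    generalize S ∪ T = V at h2
    induction h2 with
    | subset h => exact .subset (Set.union_subset Set.subset_union_left h)
    | step op ha hb h ih =>
      exact .step op ha hb (ih.mono_right (by
        rintro x (hx | hx)
        · exact Or.inl (Or.inl (Or.inr hx))
        · exact Or.inl (Or.inr hx)))
  refine (h.trans h1).mono_right ?_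
  rintro x (hx | hx)
  · exact Or.inl (Or.inl (Or.inr hx))
  · exact Or.inl (Or.inr hx)

/-- Sequential composition that keeps the results of the first stage. -/
theorem trans_union (h : Computes S n T) (h' : Computes (S ∪ T) m U) :
    Computes S (n + m) (T ∪ U) := by
  have h1 : Computes (S ∪ T) (0 + m) (T ∪ U) := (of_subset Set.subset_union_right).union h'
  rw [zero_add] at h1
  exact h.trans h1

theorem biUnion {ι : Type*} (s : Finset ι) {c : ι → ℕ} {t : ι → Set K}
    (h : ∀ i ∈ s, Computes S (c i) (t i)) : Computes S (∑ i ∈ s, c i) (⋃ i ∈ s, t i) := by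
  classical
  induction s using Finset.induction_on with
  | empty => exact .subset (by simp)
  | insert a s ha ih =>
    rw [Finset.sum_insert ha, Finset.set_biUnion_insert]
    exact (h a (Finset.mem_insert_self _ _)).union
      (ih fun i hi => h i (Finset.mem_insert_of_mem hi))

theorem biUnion_range {c : ℕ} {t : ℕ → Set K} (n : ℕ) (h : ∀ i < n, Computes S c (t i)) :
    Computes S (n * c) (⋃ i ∈ Finset.range n, t i) := by
  have := biUnion (S := S) (Finset.range n) (c := fun _ => c) (t := t)
    (fun i hi => h i (Finset.mem_range.1 hi))
  simpa using this

theorem iUnion {ι : Type*} [Fintype ι] {c : ι → ℕ} {t : ι → Set K}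
    (h : ∀ i, Computes S (c i) (t i)) : Computes S (∑ i, c i) (⋃ i, t i) := by
  have := biUnion (S := S) Finset.univ (c := c) (t := t) (fun i _ => h i)
  simpa using this

theorem op (o : RingOp) {a b : K} (ha : a ∈ S ∪ {0, 1}) (hb : b ∈ S ∪ {0, 1}) :
    Computes S 1 {o.apply a b} :=
  .step o ha hb (.subset (by simp))

theorem add {a b : K} (ha : a ∈ S ∪ {0, 1}) (hb : b ∈ S ∪ {0, 1}) : Computes S 1 {a + b} :=
  op .add ha hb

theorem sub {a b : K} (ha : a ∈ S ∪ {0, 1}) (hb : b ∈ S ∪ {0, 1}) : Computes S 1 {a - b} :=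
  op .sub ha hb

theorem mul {a b : K} (ha : a ∈ S ∪ {0, 1}) (hb : b ∈ S ∪ {0, 1}) : Computes S 1 {a * b} :=
  op .mul ha hb

theorem sum {ι : Type*} (s : Finset ι) {f : ι → K} (h : ∀ i ∈ s, f i ∈ S ∪ {0, 1}) :
    Computes S s.card {∑ i ∈ s, f i} := by
  classical
  induction s using Finset.induction_on with
  | empty => exact .subset (by simp)
  | insert a s ha ih =>
    rw [Finset.sum_insert ha, Finset.card_insert_of_notMem ha]
    refine (ih fun i hi => h i (Finset.mem_insert_of_mem hi)).trans (add ?_ ?_)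
    · rcases h a (Finset.mem_insert_self _ _) with h | h
      exacts [Or.inl (Or.inl h), Or.inr h]
    · exact Or.inl (Or.inr rfl)

/-- All powers of an element up to the `n`-th. -/
theorem powers {a : K} (ha : a ∈ S) (n : ℕ) :
    Computes S n (⋃ i ∈ Finset.range (n + 1), {a ^ i}) := by
  induction n with
  | zero => exact .subset (by simp)
  | succ n ih =>
    rw [Finset.range_add_one, Finset.set_biUnion_insert]
    have h1 : Computes (S ∪ ⋃ i ∈ Finset.range (n + 1), {a ^ i}) 1 {a ^ (n + 1)} := by
      rw [pow_succ]
      refine mul (Or.inl (Or.inr ?_)) (Or.inl (Or.inl ha))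
      simp only [Set.mem_iUnion]
      exact ⟨n, by simp, rfl⟩
    have h2 := (refl (S ∪ ⋃ i ∈ Finset.range (n + 1), {a ^ i}) (n := 0)).union h1
    refine (ih.trans h2).mono_right ?_ |>.mono_cost (by omega)
    rintro x (hx | hx)
    · exact Or.inl (Or.inr hx)
    · exact Or.inl (Or.inl (Or.inr hx))

/-- A natural number, as an element of the ring, by repeated doubling. -/
theorem natCast (S : Set K) (n : ℕ) : Computes S (2 * n.size) {(n : K)} := by
  induction n using Nat.binaryRec' with
  | zero => exact .subset (by simp)
  | bit b n hn ih =>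
    by_cases h0 : Nat.bit b n = 0
    · rw [h0]
      exact .subset (by simp)
    rw [Nat.size_bit h0]
    have h1 : Computes (S ∪ {(n : K)}) 1 {(n : K) + n} :=
      add (Or.inl (Or.inr rfl)) (Or.inl (Or.inr rfl))
    refine (ih.trans (m := 2) ((h1.trans (m := 1) ?_))).mono_cost (by omega)
    cases b
    · refine .subset ?_
      rintro x rfl
      refine Or.inl (Or.inr ?_)
      simp [Nat.bit, two_mul]
    · have h2 : Computes (S ∪ {(n : K)} ∪ {(n : K) + n}) 1 {((n : K) + n) + 1} :=
        add (Or.inl (Or.inr rfl)) (Or.inr (by simp))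
      convert h2 using 2
      simp [Nat.bit, two_mul]

end Computes

/-! ### From counted computations to straight-line programs -/

theorem Operand.val_map {R K : Type*} [CommRing R] [CommRing K] (φ : K →+* R) {ι : Type}
    (x : ι → K) (m : List K) (o : Operand ι) :
    o.val (fun i => φ (x i)) (m.map φ) = φ (o.val x m) := by
  cases o with
  | zero => simp [Operand.val]
  | one => simp [Operand.val]
  | input i => simp [Operand.val]
  | reg j =>
    simp only [Operand.val, List.getD_eq_getElem?_getD, List.getElem?_map]
    cases m[j]? <;> simp

theorem RingOp.apply_map {R K : Type*} [CommRing R] [CommRing K] (φ : K →+* R) (o : RingOp)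
    (a b : K) : o.apply (φ a) (φ b) = φ (o.apply a b) := by
  cases o <;> simp [RingOp.apply]

theorem execInstrs_map {R K : Type*} [CommRing R] [CommRing K] (φ : K →+* R) {ι : Type}
    (x : ι → K) (cs : List (Instr ι)) (m : List K) :
    execInstrs (fun i => φ (x i)) cs (m.map φ) = (execInstrs x cs m).map φ := by
  induction cs generalizing m with
  | nil => rfl
  | cons c cs ih =>
    rw [execInstrs, execInstrs, ← ih]
    simp [Operand.val_map, RingOp.apply_map]

theorem StraightLineProgram.eval_map {R K : Type*} [CommRing R] [CommRing K] (φ : K →+* R)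
    {ι κ : Type} (P : StraightLineProgram ι κ) (x : ι → K) (k : κ) :
    P.eval (fun i => φ (x i)) k = φ (P.eval x k) := by
  have := execInstrs_map φ x P.code []
  rw [List.map_nil] at this
  rw [StraightLineProgram.eval, this, Operand.val_map, StraightLineProgram.eval]

/-- A counted computation is carried out by a list of instructions. The hypothesis on `S` asks for
operands whose values do not change when further results are appended to the registers. -/
theorem Computes.exists_code {K : Type*} [CommRing K] {ι : Type} (x : ι → K) {S T : Set K} {n : ℕ}
    (h : Computes S n T) (m : List K)
    (hS : ∀ s ∈ S, ∃ o : Operand ι, ∀ m', o.val x (m ++ m') = s) :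
    ∃ cs : List (Instr ι), cs.length ≤ n ∧
      ∀ t ∈ T, ∃ o : Operand ι, o.val x (execInstrs x cs m) = t := by
  have key : ∀ (S : Set K) (m : List K),
      (∀ s ∈ S, ∃ o : Operand ι, ∀ m', o.val x (m ++ m') = s) →
      ∀ s ∈ S ∪ {0, 1}, ∃ o : Operand ι, ∀ m', o.val x (m ++ m') = s := by
    rintro S m hS s (hs | rfl | rfl)
    · exact hS s hs
    · exact ⟨.zero, fun _ => rfl⟩
    · exact ⟨.one, fun _ => rfl⟩
  induction h generalizing m with
  | subset h =>
    refine ⟨[], Nat.zero_le _, fun t ht => ?_⟩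
    obtain ⟨o, ho⟩ := key _ m hS t (h ht)
    exact ⟨o, by simpa [execInstrs] using ho []⟩
  | @step S T n op a b ha hb h ih =>
    obtain ⟨oa, hoa⟩ := key _ m hS a ha
    obtain ⟨ob, hob⟩ := key _ m hS b hb
    have ha0 : oa.val x m = a := by simpa using hoa []
    have hb0 : ob.val x m = b := by simpa using hob []
    obtain ⟨cs, hlen, hcs⟩ := ih (m ++ [op.apply a b]) (by
      rintro s (rfl | hs)
      · exact ⟨.reg m.length, fun m' => by simp [Operand.val]⟩
      · obtain ⟨o, ho⟩ := hS s hs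
        exact ⟨o, fun m' => by rw [List.append_assoc]; exact ho _⟩)
    refine ⟨⟨op, oa, ob⟩ :: cs, by simpa using hlen, fun t ht => ?_⟩
    obtain ⟨o, ho⟩ := hcs t ht
    exact ⟨o, by rw [execInstrs, ha0, hb0]; exact ho⟩

/-- A computation on generic inputs is a straight-line program, which then computes the
specialized outputs over every commutative ring. -/
theorem exists_program {ι κ : Type} {n : ℕ} (T : κ → MvPolynomial ι ℤ)
    (h : Computes (Set.range MvPolynomial.X) n (Set.range T)) :
    ∃ P : StraightLineProgram ι κ, P.cost ≤ n ∧
      ∀ (R : Type*) [CommRing R] (x : ι → R) (k : κ), P.eval x k = MvPolynomial.aeval x (T k) := by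
  obtain ⟨cs, hlen, hcs⟩ := h.exists_code MvPolynomial.X [] (by
    rintro _ ⟨i, rfl⟩
    exact ⟨.input i, fun _ => rfl⟩)
  choose out hout using fun k => hcs (T k) ⟨k, rfl⟩
  refine ⟨⟨cs, out⟩, hlen, fun R _ x k => ?_⟩
  have := StraightLineProgram.eval_map (MvPolynomial.aeval (R := ℤ) x).toRingHom ⟨cs, out⟩
    MvPolynomial.X k
  simp only [AlgHom.toRingHom_eq_coe, RingHom.coe_coe, MvPolynomial.aeval_X] at this
  rw [this]
  congr 1
  exact hout k

/-! ### Coefficients of polynomials -/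

/-- The set of all coefficients of a polynomial, including zeros. -/
def coeffSet {K : Type*} [CommRing K] (f : K[X]) : Set K := Set.range f.coeff

section Coefficients

variable {K : Type*} [CommRing K] {S T : Set K} {n : ℕ} {f g : K[X]}

theorem Computes.coeffSet {c : ℕ} (hf : f.degree < n) (h : ∀ j < n, Computes S c {f.coeff j}) :
    Computes S (n * c) (coeffSet f) := by
  refine (biUnion_range n h).mono_right ?_
  rintro _ ⟨j, rfl⟩
  rcases lt_or_ge j n with hj | hj
  · refine Or.inl ?_
    simp only [Set.mem_iUnion]
    exact ⟨j, by simpa using hj, rfl⟩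
  · exact Or.inr (by simp [(degree_lt_iff_coeff_zero f n).1 hf j hj])

theorem Computes.add_poly (hf : f.degree < n) (hg : g.degree < n) :
    Computes (_root_.coeffSet f ∪ _root_.coeffSet g) n (_root_.coeffSet (f + g)) := by
  have h : (f + g).degree < n := (degree_add_le f g).trans_lt (max_lt hf hg)
  refine (Computes.coeffSet (c := 1) h fun j _ => ?_).mono_cost (by omega)
  rw [coeff_add]
  exact add (Or.inl (Or.inl ⟨j, rfl⟩)) (Or.inl (Or.inr ⟨j, rfl⟩))

theorem Computes.sub_poly (hf : f.degree < n) (hg : g.degree < n) :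
    Computes (_root_.coeffSet f ∪ _root_.coeffSet g) n (_root_.coeffSet (f - g)) := by
  have h : (f - g).degree < n := (degree_sub_le f g).trans_lt (max_lt hf hg)
  refine (Computes.coeffSet (c := 1) h fun j _ => ?_).mono_cost (by omega)
  rw [coeff_sub]
  exact sub (Or.inl (Or.inl ⟨j, rfl⟩)) (Or.inl (Or.inr ⟨j, rfl⟩))

/-- The coefficients of `f` at the positions `s, …, s + m - 1`, as a polynomial. -/
noncomputable def window (f : K[X]) (s m : ℕ) : K[X] :=
  ∑ i ∈ Finset.range m, C (f.coeff (s + i)) * X ^ i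

theorem coeff_window (f : K[X]) (s m i : ℕ) :
    (window f s m).coeff i = if i < m then f.coeff (s + i) else 0 := by
  simp [window, coeff_C_mul, coeff_X_pow]

theorem degree_window_lt (f : K[X]) (s m : ℕ) : (window f s m).degree < m := by
  rw [degree_lt_iff_coeff_zero]
  intro i hi
  rw [coeff_window, if_neg (by omega)]

theorem coeffSet_window_subset (f : K[X]) (s m : ℕ) :
    coeffSet (window f s m) ⊆ coeffSet f ∪ {0, 1} := by
  rintro _ ⟨i, rfl⟩
  rw [coeff_window]
  split_ifs
  · exact Or.inl ⟨_, rfl⟩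
  · exact Or.inr (by simp)

theorem window_add_X_pow_mul_window (s t m : ℕ) (f : K[X]) :
    window f s m + X ^ m * window f (s + m) t = window f s (m + t) := by
  ext i
  rw [coeff_add, coeff_X_pow_mul', coeff_window, coeff_window, coeff_window]
  split_ifs <;> first | omega | simp
  rw [show s + m + (i - m) = s + i by omega]

theorem window_zero_of_degree_lt {m : ℕ} (hf : f.degree < m) : window f 0 m = f := by
  ext i
  rw [coeff_window]
  split_ifs with h
  · simp
  · exact ((degree_lt_iff_coeff_zero f m).1 hf i (by omega)).symm

end Coefficients

/-! ### The cyclic algebra `K[x]/(x ^ q - 1)` and the fast Fourier transform -/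

section Cyclic

variable {K : Type*} [CommRing K] {q : ℕ}

/-- The coordinates of an element of `K[x]/(x ^ q - 1)`, which is encoded as the group algebra of
`ZMod q`. -/
def coordSet (h : AddMonoidAlgebra K (ZMod q)) : Set K := Set.range h.coeff

/-- The power `x ^ s` of the generator of the cyclic algebra, a root of unity. -/
noncomputable def root (K : Type*) [CommRing K] {q : ℕ} (s : ZMod q) :
    AddMonoidAlgebra K (ZMod q) :=
  AddMonoidAlgebra.single s 1

theorem root_mul_root (s t : ZMod q) : root K s * root K t = root K (s + t) := by
  simp [root, AddMonoidAlgebra.single_mul_single]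

theorem root_zero : root K (0 : ZMod q) = 1 := rfl

theorem root_pow (s : ZMod q) (n : ℕ) : root K s ^ n = root K ((n : ZMod q) * s) := by
  simp [root, AddMonoidAlgebra.single_pow]

theorem coeff_mul_root (h : AddMonoidAlgebra K (ZMod q)) (s i : ZMod q) :
    (h * root K s).coeff i = h.coeff (i - s) := by
  simp [root, AddMonoidAlgebra.coeff_mul_single_apply, sub_eq_add_neg]

theorem coordSet_mul_root (h : AddMonoidAlgebra K (ZMod q)) (s : ZMod q) :
    coordSet (h * root K s) ⊆ coordSet h := by
  rintro _ ⟨i, rfl⟩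
  exact ⟨i - s, (coeff_mul_root h s i).symm⟩

/-- The values `∑ b < n, c b * w ^ (j * b)` of the polynomial with coefficients `c b` in the cyclic
algebra at the powers of `w = x ^ s`. -/
noncomputable def dft (n : ℕ) (c : ℕ → AddMonoidAlgebra K (ZMod q)) (s : ZMod q) (j : ℕ) :
    AddMonoidAlgebra K (ZMod q) :=
  ∑ b ∈ Finset.range n, c b * root K (((j * b : ℕ) : ZMod q) * s)

theorem dft_add_period {n : ℕ} {s : ZMod q} (hs : (n : ZMod q) * s = 0)
    (c : ℕ → AddMonoidAlgebra K (ZMod q)) (m j k : ℕ) : dft m c s (j + n * k) = dft m c s j := by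
  refine Finset.sum_congr rfl fun b _ => ?_
  congr 2
  push_cast
  linear_combination (k * b : ZMod q) * hs

theorem sum_range_mul_eq_sum_sum {A : Type*} [AddCommMonoid A] (p n : ℕ) (f : ℕ → A) :
    ∑ i ∈ Finset.range (p * n), f i =
      ∑ a ∈ Finset.range p, ∑ b ∈ Finset.range n, f (p * b + a) := by
  rw [Finset.sum_comm]
  induction n with
  | zero => simp
  | succ n ih => rw [mul_add_one, Finset.sum_range_add, ih, Finset.sum_range_succ]

/-- Decimation in time. -/
theorem dft_mul (p n : ℕ) (c : ℕ → AddMonoidAlgebra K (ZMod q)) (s : ZMod q) (j : ℕ) :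
    dft (p * n) c s j = ∑ a ∈ Finset.range p,
      dft n (fun b => c (p * b + a)) (p * s) j * root K (((j * a : ℕ) : ZMod q) * s) := by
  rw [dft, sum_range_mul_eq_sum_sum]
  refine Finset.sum_congr rfl fun a _ => ?_
  rw [dft, Finset.sum_mul]
  refine Finset.sum_congr rfl fun b _ => ?_
  rw [mul_assoc, root_mul_root]
  congr 2
  push_cast
  ring

theorem Computes.coordSet [NeZero q] {S : Set K} {c : ℕ} {h : AddMonoidAlgebra K (ZMod q)}
    (hc : ∀ i, Computes S c {h.coeff i}) : Computes S (q * c) (coordSet h) := by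
  have := Computes.iUnion hc
  simp only [Finset.sum_const, Finset.card_univ, ZMod.card, smul_eq_mul] at this
  refine this.mono_right ?_
  rintro _ ⟨i, rfl⟩
  exact Or.inl (Set.mem_iUnion.2 ⟨i, rfl⟩)

/-- The fast Fourier transform. Multiplications by powers of `x` only permute coordinates, so that
only the additions are counted. -/
theorem Computes.dft [NeZero q] {p : ℕ} (hp : p ≠ 0) {S : Set K} (r : ℕ)
    (c : ℕ → AddMonoidAlgebra K (ZMod q)) (s : ZMod q) (hs : ((p ^ r : ℕ) : ZMod q) * s = 0)
    (hc : ∀ b < p ^ r, _root_.coordSet (c b) ⊆ S ∪ {0, 1}) :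
    Computes S (r * p ^ (r + 1) * q) (⋃ j, _root_.coordSet (_root_.dft (p ^ r) c s j)) := by
  induction r generalizing c s with
  | zero =>
    refine .subset (Set.iUnion_subset fun j => ?_)
    have : _root_.dft (p ^ 0) c s j = c 0 := by simp [_root_.dft, root_zero]
    rw [this]
    exact hc 0 (by simp)
  | succ r ih =>
    have h1 := Computes.biUnion_range (S := S) p fun a ha =>
      ih (fun b => c (p * b + a)) (p * s) (by rw [← hs]; push_cast; ring) fun b hb => hc _ (by
        calc p * b + a < p * (b + 1) := by rw [mul_add_one]; omega
          _ ≤ p * p ^ r := Nat.mul_le_mul_left _ hb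
          _ = p ^ (r + 1) := by ring)
    set U := ⋃ a ∈ Finset.range p,
      ⋃ j, _root_.coordSet (_root_.dft (p ^ r) (fun b => c (p * b + a)) (p * s) j) with hU
    have h2 : Computes (S ∪ U) (p ^ (r + 1) * (q * p))
        (⋃ j ∈ Finset.range (p ^ (r + 1)), _root_.coordSet (_root_.dft (p ^ (r + 1)) c s j)) := by
      refine Computes.biUnion_range _ fun j _ => Computes.coordSet fun i => ?_
      rw [show p ^ (r + 1) = p * p ^ r by ring, dft_mul, AddMonoidAlgebra.coeff_sum,
        Finsupp.finsetSum_apply]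
      refine (Computes.sum (Finset.range p) fun a ha => ?_).mono_cost (by simp)
      refine Or.inl (Or.inr ?_)
      rw [hU]
      simp only [Set.mem_iUnion]
      exact ⟨a, ha, j, coordSet_mul_root _ _ ⟨i, rfl⟩⟩
    refine ((h1.trans h2).mono_right ?_).mono_cost (le_of_eq (by ring))
    refine Set.iUnion_subset fun j => ?_
    have hj : _root_.dft (p ^ (r + 1)) c s j =
        _root_.dft (p ^ (r + 1)) c s (j % p ^ (r + 1)) := by
      conv_lhs => rw [← Nat.mod_add_div j (p ^ (r + 1))]
      exact dft_add_period hs _ _ _ _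
    rw [hj]
    intro x hx
    refine Or.inl ?_
    simp only [Set.mem_iUnion]
    exact ⟨j % p ^ (r + 1), Finset.mem_range.2 (Nat.mod_lt _ (by positivity)), hx⟩

theorem sum_range_zmod {A : Type*} [AddCommMonoid A] [NeZero q] (f : ZMod q → A) :
    ∑ j ∈ Finset.range q, f (j : ZMod q) = ∑ j : ZMod q, f j := by
  refine Finset.sum_bij (fun j _ => (j : ZMod q)) (fun _ _ => Finset.mem_univ _) ?_ ?_ ?_
  · intro a ha b hb h
    rw [ZMod.natCast_eq_natCast_iff'] at h
    rwa [Nat.mod_eq_of_lt (Finset.mem_range.1 ha), Nat.mod_eq_of_lt (Finset.mem_range.1 hb)] at h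
  · intro j _
    exact ⟨j.val, Finset.mem_range.2 (ZMod.val_lt j), by simp⟩
  · intros; rfl

/-- A nonzero residue modulo a prime power `p ^ (k + 1)` divides `p ^ k`. -/
theorem exists_mul_eq_prime_pow {p k : ℕ} (hp : p.Prime) (d : ZMod (p ^ (k + 1))) (hd : d ≠ 0) :
    ∃ s : ZMod (p ^ (k + 1)), s * d = ((p ^ k : ℕ) : ZMod (p ^ (k + 1))) := by
  have : NeZero (p ^ (k + 1)) := ⟨(pow_pos hp.pos _).ne'⟩
  obtain ⟨a, ha, hga⟩ := (Nat.dvd_prime_pow hp).1 (Nat.gcd_dvd_right d.val (p ^ (k + 1)))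
  have hak : a ≤ k := by
    by_contra hcon
    have : a = k + 1 := by omega
    rw [this] at hga
    have h1 : p ^ (k + 1) ∣ d.val := hga.symm.dvd.trans (Nat.gcd_dvd_left _ _)
    have h2 := Nat.eq_zero_of_dvd_of_lt h1 (ZMod.val_lt d)
    exact hd ((ZMod.val_eq_zero d).1 h2)
  have hb := Nat.gcd_eq_gcd_ab d.val (p ^ (k + 1))
  rw [hga] at hb
  have hb' := congrArg (fun z : ℤ => (z : ZMod (p ^ (k + 1)))) hb
  simp only [Int.cast_natCast, Int.cast_add, Int.cast_mul] at hb'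
  rw [ZMod.natCast_self, zero_mul, add_zero, ZMod.natCast_zmod_val] at hb'
  refine ⟨((d.val.gcdA (p ^ (k + 1)) : ℤ) : ZMod (p ^ (k + 1))) * ((p ^ (k - a) : ℕ) : ZMod _), ?_⟩
  rw [mul_right_comm, mul_comm _ d, ← hb', ← Nat.cast_mul, ← pow_add]
  congr 2
  omega

/-- The orthogonality relation. Without the factor `1 - x ^ (p ^ k)` the sum need not vanish, as
the powers of `x` are no principal roots of unity in the cyclic algebra. -/
theorem one_sub_root_mul_sum {p k : ℕ} (hp : p.Prime) (d : ZMod (p ^ (k + 1))) (hd : d ≠ 0) :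
    (1 - root K ((p ^ k : ℕ) : ZMod (p ^ (k + 1)))) *
      ∑ j ∈ Finset.range (p ^ (k + 1)), root K ((j : ZMod (p ^ (k + 1))) * d) = 0 := by
  have : NeZero (p ^ (k + 1)) := ⟨(pow_pos hp.pos _).ne'⟩
  obtain ⟨s, hs⟩ := exists_mul_eq_prime_pow hp d hd
  rw [sum_range_zmod (fun j : ZMod (p ^ (k + 1)) => root K (j * d)), sub_mul, one_mul, sub_eq_zero,
    Finset.mul_sum, ← hs]
  simp_rw [root_mul_root, ← add_mul]
  exact (Fintype.sum_equiv (Equiv.addLeft s) _ _ fun j => rfl).symm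

/-- The discrete Fourier transform is inverted by the transform at the inverse root of unity, up to
the factor `p ^ (k + 1)` and on the quotient by the annihilator of `1 - x ^ (p ^ k)`. -/
theorem one_sub_root_mul_dft_dft {p k : ℕ} (hp : p.Prime)
    (c : ℕ → AddMonoidAlgebra K (ZMod (p ^ (k + 1)))) {b : ℕ} (hb : b < p ^ (k + 1)) :
    (1 - root K ((p ^ k : ℕ) : ZMod (p ^ (k + 1)))) *
        dft (p ^ (k + 1)) (dft (p ^ (k + 1)) c 1) (-1) b =
      (1 - root K ((p ^ k : ℕ) : ZMod (p ^ (k + 1)))) *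
        ((p : AddMonoidAlgebra K (ZMod (p ^ (k + 1)))) ^ (k + 1) * c b) := by
  have h1 : dft (p ^ (k + 1)) (dft (p ^ (k + 1)) c 1) (-1) b =
      ∑ b' ∈ Finset.range (p ^ (k + 1)), c b' *
        ∑ j ∈ Finset.range (p ^ (k + 1)),
          root K ((j : ZMod (p ^ (k + 1))) *
            ((b' : ZMod (p ^ (k + 1))) - (b : ZMod (p ^ (k + 1))))) := by
    simp_rw [dft, Finset.sum_mul, Finset.mul_sum]
    rw [Finset.sum_comm]
    refine Finset.sum_congr rfl fun b' _ => Finset.sum_congr rfl fun j _ => ?_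
    rw [mul_assoc, root_mul_root]
    congr 2
    push_cast
    ring
  rw [h1, Finset.mul_sum, Finset.sum_eq_single b]
  · simp [root_zero]
    ring
  · intro b' hb' hne
    rw [mul_left_comm, one_sub_root_mul_sum hp, mul_zero]
    rw [sub_ne_zero, Ne, ZMod.natCast_eq_natCast_iff', Nat.mod_eq_of_lt hb,
      Nat.mod_eq_of_lt (Finset.mem_range.1 hb')]
    exact hne
  · intro h
    exact absurd (Finset.mem_range.2 hb) h

/-- Reduction of polynomials modulo `x ^ q - 1`. -/
noncomputable def toCyclic (K : Type*) [CommRing K] (q : ℕ) :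
    K[X] →ₐ[K] AddMonoidAlgebra K (ZMod q) :=
  aeval (root K 1)

theorem toCyclic_eq_sum {n : ℕ} {f : K[X]} (hf : f.degree < n) :
    toCyclic K q f = ∑ j ∈ Finset.range n, AddMonoidAlgebra.single (j : ZMod q) (f.coeff j) := by
  conv_lhs => rw [← window_zero_of_degree_lt hf]
  simp only [window, map_sum, map_mul, map_pow, toCyclic, aeval_X, aeval_C, root_pow]
  refine Finset.sum_congr rfl fun j _ => ?_
  simp [root, AddMonoidAlgebra.single_mul_single]

theorem coeff_toCyclic_natCast {f : K[X]} (hf : f.degree < (q + q : ℕ)) {i : ℕ} (hi : i < q) :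
    (toCyclic K q f).coeff (i : ZMod q) = f.coeff i + f.coeff (i + q) := by
  rw [toCyclic_eq_sum hf, AddMonoidAlgebra.coeff_sum, Finsupp.finsetSum_apply,
    Finset.sum_range_add]
  congr 1
  · rw [Finset.sum_eq_single i]
    · simp
    · intro j hj hji
      rw [AddMonoidAlgebra.coeff_single, Finsupp.single_apply, if_neg]
      rw [ZMod.natCast_eq_natCast_iff', Nat.mod_eq_of_lt hi,
        Nat.mod_eq_of_lt (Finset.mem_range.1 hj)]
      exact hji
    · simp [hi]
  · rw [Finset.sum_eq_single i]
    · simp [add_comm]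
    · intro j hj hji
      rw [AddMonoidAlgebra.coeff_single, Finsupp.single_apply, if_neg]
      rw [Nat.cast_add, ZMod.natCast_self, zero_add,
        ZMod.natCast_eq_natCast_iff', Nat.mod_eq_of_lt hi,
        Nat.mod_eq_of_lt (Finset.mem_range.1 hj)]
      exact hji
    · simp [hi]

theorem coeff_toCyclic_natCast_of_degree_lt {f : K[X]} (hf : f.degree < q) {i : ℕ} (hi : i < q) :
    (toCyclic K q f).coeff (i : ZMod q) = f.coeff i := by
  rw [coeff_toCyclic_natCast (hf.trans_le (by exact_mod_cast Nat.le_add_left q q)) hi,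
    (degree_lt_iff_coeff_zero f q).1 hf _ (Nat.le_add_left q i), add_zero]

theorem coordSet_toCyclic_subset [NeZero q] {f : K[X]} (hf : f.degree < q) :
    coordSet (toCyclic K q f) ⊆ coeffSet f := by
  rintro _ ⟨i, rfl⟩
  refine ⟨i.val, ?_⟩
  rw [← coeff_toCyclic_natCast_of_degree_lt hf (ZMod.val_lt i), ZMod.natCast_zmod_val]

theorem exists_toCyclic_eq [NeZero q] (h : AddMonoidAlgebra K (ZMod q)) :
    ∃ f : K[X], f.degree < q ∧ toCyclic K q f = h ∧ coeffSet f ⊆ coordSet h ∪ {0, 1} := by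
  have hcoeff : ∀ j, (∑ i ∈ Finset.range q, C (h.coeff (i : ZMod q)) * X ^ i : K[X]).coeff j =
      if j < q then h.coeff (j : ZMod q) else 0 := by
    intro j
    simp [coeff_X_pow]
  have hdeg : (∑ i ∈ Finset.range q, C (h.coeff (i : ZMod q)) * X ^ i : K[X]).degree < q := by
    rw [degree_lt_iff_coeff_zero]
    intro j hj
    rw [hcoeff, if_neg (by omega)]
  refine ⟨_, hdeg, ?_, ?_⟩
  · ext i
    have := coeff_toCyclic_natCast_of_degree_lt hdeg (ZMod.val_lt i)
    rw [hcoeff, if_pos (ZMod.val_lt i), ZMod.natCast_zmod_val] at this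
    exact this
  · rintro _ ⟨j, rfl⟩
    rw [hcoeff]
    split_ifs
    · exact Or.inl ⟨_, rfl⟩
    · exact Or.inr (by simp)

/-- Reading off a polynomial of degree less than `p ^ k` after multiplication by
`1 - x ^ (p ^ k)`. -/
theorem coeff_one_sub_root_mul_toCyclic {p k : ℕ} (hp : 2 ≤ p) {f : K[X]}
    (hf : f.degree < (p ^ k : ℕ)) {i : ℕ} (hi : i < p ^ k) :
    ((1 - root K ((p ^ k : ℕ) : ZMod (p ^ (k + 1)))) * toCyclic K (p ^ (k + 1)) f).coeff
      (i : ZMod (p ^ (k + 1))) = f.coeff i := by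
  have h2 : 2 * p ^ k ≤ p ^ (k + 1) := by
    rw [pow_succ, mul_comm]
    exact Nat.mul_le_mul_left _ hp
  have hf' : f.degree < (p ^ (k + 1) : ℕ) := hf.trans_le (by exact_mod_cast (by omega))
  rw [sub_mul, one_mul, mul_comm, AddMonoidAlgebra.coeff_sub, Finsupp.sub_apply, coeff_mul_root,
    coeff_toCyclic_natCast_of_degree_lt hf' (by omega)]
  have h3 : (i : ZMod (p ^ (k + 1))) - ((p ^ k : ℕ) : ZMod (p ^ (k + 1))) =
      ((i + (p ^ (k + 1) - p ^ k) : ℕ) : ZMod (p ^ (k + 1))) := by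
    rw [Nat.cast_add, Nat.cast_sub (by omega), ZMod.natCast_self]
    ring
  rw [h3, coeff_toCyclic_natCast_of_degree_lt hf' (by omega),
    (degree_lt_iff_coeff_zero f _).1 hf (i + (p ^ (k + 1) - p ^ k)) (by omega), sub_zero]

end Cyclic

/-! ### Products up to a power of a prime -/

section ScaledMul

variable {K : Type*} [CommRing K]

/-- Over `K`, the multiple `p ^ e * f * g` of the product of two polynomials of degrees less than
`p ^ k` can be computed with `t` operations. -/
def ScaledMul (K : Type*) [CommRing K] (p k e t : ℕ) : Prop :=
  ∀ f g : K[X], f.degree < (p ^ k : ℕ) → g.degree < (p ^ k : ℕ) →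
    Computes (coeffSet f ∪ coeffSet g) t (coeffSet (C ((p : K) ^ e) * (f * g)))

theorem degree_mul_lt_add {m n : ℕ} {f g : K[X]} (hf : f.degree < m) (hg : g.degree < n) :
    (f * g).degree < (m + n : ℕ) := by
  rw [degree_lt_iff_coeff_zero] at *
  intro i hi
  rw [coeff_mul]
  refine Finset.sum_eq_zero fun x hx => ?_
  rw [Finset.HasAntidiagonal.mem_antidiagonal] at hx
  rcases lt_or_ge x.1 m with h | h
  · rw [hg _ (by omega), mul_zero]
  · rw [hf _ h, zero_mul]

theorem degree_C_mul_lt {n : WithBot ℕ} {f : K[X]} (a : K) (hf : f.degree < n) :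
    (C a * f).degree < n :=
  (C_mul' a f ▸ degree_smul_le a f).trans_lt hf

/-- Schoolbook multiplication. -/
theorem Computes.mul_schoolbook {n : ℕ} {f g : K[X]} (hf : f.degree < n) (hg : g.degree < n) :
    Computes (_root_.coeffSet f ∪ _root_.coeffSet g) (8 * n ^ 2) (_root_.coeffSet (f * g)) := by
  refine (Computes.coeffSet (c := 4 * n) (degree_mul_lt_add hf hg) fun j hj => ?_).mono_cost
    (le_of_eq (by ring))
  rw [coeff_mul]
  have h1 := Computes.biUnion (S := _root_.coeffSet f ∪ _root_.coeffSet g)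
    (Finset.HasAntidiagonal.antidiagonal j) (c := fun _ => 1)
    (t := fun x => {f.coeff x.1 * g.coeff x.2})
    (fun x _ => Computes.mul (Or.inl (Or.inl ⟨_, rfl⟩)) (Or.inl (Or.inr ⟨_, rfl⟩)))
  refine (h1.trans (Computes.sum (Finset.HasAntidiagonal.antidiagonal j)
    fun x hx => Or.inl (Or.inr ?_))).mono_cost ?_
  · simp only [Set.mem_iUnion]
    exact ⟨x, hx, rfl⟩
  · simp
    omega

theorem ScaledMul.schoolbook (p k : ℕ) : ScaledMul K p k 0 (8 * (p ^ k) ^ 2) := by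
  intro f g hf hg
  simpa using Computes.mul_schoolbook hf hg

theorem ScaledMul.mono {p k e t t' : ℕ} (h : ScaledMul K p k e t) (ht : t ≤ t') :
    ScaledMul K p k e t' := fun f g hf hg => (h f g hf hg).mono_cost ht

/-- Products in the cyclic algebra, by multiplication of representatives and folding. -/
theorem ScaledMul.computes_cyclic {p k e t : ℕ} (hp : p ≠ 0) (h : ScaledMul K p k e t) {S : Set K}
    {u v : AddMonoidAlgebra K (ZMod (p ^ k))} (hu : coordSet u ⊆ S) (hv : coordSet v ⊆ S) :
    Computes S (t + p ^ k)
      (coordSet ((p : AddMonoidAlgebra K (ZMod (p ^ k))) ^ e * (u * v))) := by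
  have : NeZero (p ^ k) := ⟨pow_ne_zero _ hp⟩
  obtain ⟨f, hf, rfl, hfu⟩ := exists_toCyclic_eq u
  obtain ⟨g, hg, rfl, hgv⟩ := exists_toCyclic_eq v
  have h1 := (h f g hf hg).mono_left (S' := S) (Set.union_subset
    (hfu.trans (Set.union_subset_union_left _ hu)) (hgv.trans (Set.union_subset_union_left _ hv)))
  have h2 : (p : AddMonoidAlgebra K (ZMod (p ^ k))) ^ e * (toCyclic K (p ^ k) f *
      toCyclic K (p ^ k) g) = toCyclic K (p ^ k) (C ((p : K) ^ e) * (f * g)) := by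
    simp [map_mul]
  have hdeg := degree_C_mul_lt ((p : K) ^ e) (degree_mul_lt_add hf hg)
  rw [h2]
  refine (h1.trans (Computes.coordSet (c := 1) fun i => ?_)).mono_cost (by omega)
  rw [← ZMod.natCast_zmod_val i, coeff_toCyclic_natCast hdeg (ZMod.val_lt i)]
  exact Computes.add (Or.inl (Or.inr ⟨_, rfl⟩)) (Or.inl (Or.inr ⟨_, rfl⟩))

/-- The coefficients of a concatenation of blocks of length `m` are those of the blocks. -/
theorem coeffSet_sum_X_pow_mul_subset {m : ℕ} (B : ℕ → K[X]) (n : ℕ)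
    (hB : ∀ b < n, (B b).degree < m) :
    (∑ b ∈ Finset.range n, X ^ (m * b) * B b).degree < ((m * n : ℕ) : WithBot ℕ) ∧
      coeffSet (∑ b ∈ Finset.range n, X ^ (m * b) * B b) ⊆
        (⋃ b ∈ Finset.range n, coeffSet (B b)) ∪ {0, 1} := by
  induction n with
  | zero =>
    simp [coeffSet, Set.subset_def]
  | succ n ih =>
    obtain ⟨h1, h2⟩ := ih fun b hb => hB b (by omega)
    have h3 := hB n (by omega)
    rw [degree_lt_iff_coeff_zero] at h1 h3
    rw [Finset.sum_range_succ]
    constructor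
    · rw [degree_lt_iff_coeff_zero]
      intro i hi
      rw [mul_add_one] at hi
      rw [coeff_add, coeff_X_pow_mul', if_pos (by omega), h1 i (by omega), h3 _ (by omega),
        add_zero]
    · rintro _ ⟨i, rfl⟩
      rw [coeff_add, coeff_X_pow_mul', Finset.range_add_one, Finset.set_biUnion_insert]
      split_ifs with h
      · rw [h1 i h, zero_add]
        exact Or.inl (Or.inl ⟨_, rfl⟩)
      · rw [add_zero]
        rcases h2 ⟨i, rfl⟩ with h | h
        exacts [Or.inl (Or.inr h), Or.inr h]

/-- Overlapping blocks of length `2 * m` are put together by one addition of polynomials. -/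
theorem Computes.sum_X_pow_mul {m n : ℕ} (B : ℕ → K[X]) (hB : ∀ b < n, (B b).degree < (m + m : ℕ))
    {S : Set K} (hS : ∀ b < n, _root_.coeffSet (B b) ⊆ S ∪ {0, 1}) :
    Computes S (m * n + m) (_root_.coeffSet (∑ b ∈ Finset.range n, X ^ (m * b) * B b)) := by
  obtain ⟨h1, h2⟩ := coeffSet_sum_X_pow_mul_subset (fun b => window (B b) 0 m) n
    fun b _ => degree_window_lt _ _ _
  obtain ⟨h3, h4⟩ := coeffSet_sum_X_pow_mul_subset (fun b => window (B b) m m) n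
    fun b _ => degree_window_lt _ _ _
  have heq : ∑ b ∈ Finset.range n, X ^ (m * b) * B b =
      ∑ b ∈ Finset.range n, X ^ (m * b) * window (B b) 0 m +
        X ^ m * ∑ b ∈ Finset.range n, X ^ (m * b) * window (B b) m m := by
    rw [Finset.mul_sum, ← Finset.sum_add_distrib]
    refine Finset.sum_congr rfl fun b hb => ?_
    have := window_add_X_pow_mul_window 0 m m (B b)
    rw [zero_add, window_zero_of_degree_lt (hB b (Finset.mem_range.1 hb))] at this
    conv_lhs => rw [← this]
    ring
  have hsub : ∀ s, (⋃ b ∈ Finset.range n, _root_.coeffSet (window (B b) s m)) ∪ {0, 1} ⊆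
      S ∪ {0, 1} := by
    intro s
    refine Set.union_subset (Set.iUnion₂_subset fun b hb => ?_) Set.subset_union_right
    refine (coeffSet_window_subset _ _ _).trans ?_
    exact Set.union_subset (hS b (Finset.mem_range.1 hb)) Set.subset_union_right
  rw [heq]
  have h5 : (X ^ m * ∑ b ∈ Finset.range n, X ^ (m * b) * window (B b) m m).degree <
      (m * n + m : ℕ) := by
    rw [degree_lt_iff_coeff_zero] at h3 ⊢
    intro i hi
    rw [coeff_X_pow_mul', if_pos (by omega), h3 _ (by omega)]
  refine (Computes.add_poly (h1.trans_le (by exact_mod_cast Nat.le_add_right _ _)) h5).mono_left ?_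
  refine Set.union_subset (h2.trans (hsub 0)) ?_
  rintro _ ⟨i, rfl⟩
  rw [coeff_X_pow_mul']
  split_ifs
  · exact hsub m (h4 ⟨_, rfl⟩)
  · exact Or.inr (by simp)

theorem sum_X_pow_mul_window {m n : ℕ} {f : K[X]} (hf : f.degree < (m * n : ℕ)) :
    ∑ b ∈ Finset.range n, X ^ (m * b) * window f (m * b) m = f := by
  have : ∀ n, ∑ b ∈ Finset.range n, X ^ (m * b) * window f (m * b) m = window f 0 (m * n) := by
    intro n
    induction n with
    | zero => simp [window]
    | succ n ih =>
      rw [Finset.sum_range_succ, ih, mul_add_one, ← window_add_X_pow_mul_window 0 m (m * n),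
        zero_add]
  rw [this, window_zero_of_degree_lt hf]

/-- The bivariate polynomial in which the blocks of length `m` of `f` are the coefficients, so that
substituting `X ^ m` for the outer variable gives back `f`. -/
noncomputable def blocks (f : K[X]) (m n : ℕ) : K[X][X] :=
  ∑ b ∈ Finset.range n, C (window f (m * b) m) * X ^ b

theorem coeff_blocks (f : K[X]) (m n b : ℕ) :
    (blocks f m n).coeff b = if b < n then window f (m * b) m else 0 := by
  simp [blocks, coeff_X_pow]

theorem degree_blocks_lt (f : K[X]) (m n : ℕ) : (blocks f m n).degree < n := by
  rw [degree_lt_iff_coeff_zero]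
  intro i hi
  rw [coeff_blocks, if_neg (by omega)]

theorem eval_blocks {f : K[X]} {m n : ℕ} (hf : f.degree < (m * n : ℕ)) :
    (blocks f m n).eval (X ^ m) = f := by
  conv_rhs => rw [← sum_X_pow_mul_window hf]
  rw [blocks, eval_finsetSum]
  refine Finset.sum_congr rfl fun b _ => ?_
  rw [eval_C_mul, eval_pow, eval_X, pow_mul, mul_comm]

theorem eval₂_eq_sum_of_degree_lt {A B : Type*} [CommRing A] [CommRing B] (φ : A →+* B) (x : B)
    {n : ℕ} {F : A[X]} (hF : F.degree < n) :
    F.eval₂ φ x = ∑ b ∈ Finset.range n, φ (F.coeff b) * x ^ b := by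
  conv_lhs => rw [← window_zero_of_degree_lt hF]
  simp [window, eval₂_finsetSum]

theorem dft_toCyclic_coeff {q : ℕ} {F : K[X][X]} (hF : F.degree < q) (j : ℕ) :
    dft q (fun b => toCyclic K q (F.coeff b)) 1 j =
      F.eval₂ (toCyclic K q : K[X] →+* AddMonoidAlgebra K (ZMod q)) (root K (j : ZMod q)) := by
  rw [eval₂_eq_sum_of_degree_lt _ _ hF, dft]
  refine Finset.sum_congr rfl fun b _ => ?_
  rw [root_pow]
  simp [mul_comm]

theorem degree_coeff_mul_lt {m : ℕ} {F G : K[X][X]} (hF : ∀ b, (F.coeff b).degree < m)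
    (hG : ∀ b, (G.coeff b).degree < m) (b : ℕ) : ((F * G).coeff b).degree < (m + m : ℕ) := by
  rw [coeff_mul]
  rw [← mem_degreeLT]
  exact Submodule.sum_mem _ fun x _ => mem_degreeLT.2 (degree_mul_lt_add (hF _) (hG _))

/-- Schönhage's recursion: polynomials of degree less than `m * n` are cut into `n` blocks of
length `m`, and the product of the two polynomials with these coefficients is found from its values
at the `q`-th roots of unity in the algebra `K[x]/(x ^ q - 1)`, where `q = p ^ (k + 1)`. -/
theorem ScaledMul.computes_mul {p k e t m n : ℕ} (hp : p.Prime) (h : ScaledMul K p (k + 1) e t)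
    (hm : m + m ≤ p ^ k) (hn : n + n ≤ p ^ (k + 1)) {f g : K[X]} (hf : f.degree < (m * n : ℕ))
    (hg : g.degree < (m * n : ℕ)) :
    Computes (coeffSet f ∪ coeffSet g)
      (p ^ (k + 1) * t + (3 * (k + 1) * p + 3) * (p ^ (k + 1)) ^ 2)
      (coeffSet (C ((p : K) ^ (e + (k + 1))) * (f * g))) := by
  set q := p ^ (k + 1) with hq
  have hq0 : 0 < q := pow_pos hp.pos _
  have : NeZero q := ⟨hq0.ne'⟩
  have hMq : p ^ k ≤ q := Nat.pow_le_pow_right hp.pos (Nat.le_succ k)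
  let F := blocks f m n
  let G := blocks g m n
  have hFG : (F * G).degree < (n + n : ℕ) :=
    degree_mul_lt_add (degree_blocks_lt f m n) (degree_blocks_lt g m n)
  have hFGq : (F * G).degree < q := hFG.trans_le (by exact_mod_cast hn)
  have hnq : (n : WithBot ℕ) ≤ q := by exact_mod_cast (by omega : n ≤ q)
  have hblock : ∀ (f : K[X]) b, ((blocks f m n).coeff b).degree < m := by
    intro f b
    rw [coeff_blocks]
    split_ifs
    · exact degree_window_lt _ _ _
    · rw [degree_zero]
      exact WithBot.bot_lt_coe _
  have hblockS : ∀ (f : K[X]) b, coordSet (toCyclic K q ((blocks f m n).coeff b)) ⊆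
      coeffSet f ∪ {0, 1} := by
    intro f b
    refine (coordSet_toCyclic_subset ((hblock f b).trans_le ?_)).trans ?_
    · exact_mod_cast (by omega : m ≤ q)
    · rw [coeff_blocks]
      split_ifs
      · exact coeffSet_window_subset _ _ _
      · rintro _ ⟨i, rfl⟩
        exact Or.inr (by simp)
  have hfft : ∀ f : K[X], Computes (coeffSet f) ((k + 1) * p ^ (k + 1 + 1) * q)
      (⋃ j, coordSet (dft q (fun b => toCyclic K q ((blocks f m n).coeff b)) 1 j)) := fun f =>
    Computes.dft hp.ne_zero (k + 1) _ 1 (by rw [← hq, ZMod.natCast_self, zero_mul])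
      fun b _ => hblockS f b
  -- the values of the product, up to the factor `p ^ e`
  let V : ℕ → AddMonoidAlgebra K (ZMod q) := fun j =>
    (p : AddMonoidAlgebra K (ZMod q)) ^ e * (dft q (fun b => toCyclic K q (F.coeff b)) 1 j *
      dft q (fun b => toCyclic K q (G.coeff b)) 1 j)
  have hV : V = dft q (fun b => toCyclic K q ((C (C ((p : K) ^ e)) * (F * G)).coeff b)) 1 := by
    funext j
    have hdeg : (C (C ((p : K) ^ e)) * (F * G)).degree < q := degree_C_mul_lt _ hFGq
    rw [dft_toCyclic_coeff hdeg]
    simp only [V]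
    rw [dft_toCyclic_coeff ((degree_blocks_lt f m n).trans_le hnq),
      dft_toCyclic_coeff ((degree_blocks_lt g m n).trans_le hnq), eval₂_mul, eval₂_mul, eval₂_C]
    simp [F, G]
  -- the inverse transform, from which the blocks of the product are read off
  let W := dft q V (-1)
  have hW : ∀ b < q, ∀ i < p ^ k, (C ((p : K) ^ (e + (k + 1))) * (F * G).coeff b).coeff i =
      (W b).coeff (i : ZMod q) - (W b).coeff (((i : ZMod q)) - ((p ^ k : ℕ) : ZMod q)) := by
    intro b hb i hi
    have h1 : (1 - root K ((p ^ k : ℕ) : ZMod q)) * dft q (dft q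
        (fun b => toCyclic K q ((C (C ((p : K) ^ e)) * (F * G)).coeff b)) 1) (-1) b =
        (1 - root K ((p ^ k : ℕ) : ZMod q)) * ((p : AddMonoidAlgebra K (ZMod q)) ^ (k + 1) *
          toCyclic K q ((C (C ((p : K) ^ e)) * (F * G)).coeff b)) :=
      one_sub_root_mul_dft_dft hp _ hb
    rw [← hV] at h1
    have h2 : (p : AddMonoidAlgebra K (ZMod q)) ^ (k + 1) *
        toCyclic K q ((C (C ((p : K) ^ e)) * (F * G)).coeff b) =
        toCyclic K q (C ((p : K) ^ (e + (k + 1))) * (F * G).coeff b) := by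
      rw [coeff_C_mul, pow_add _ e, C_mul]
      simp only [map_mul, map_pow, map_natCast]
      ring
    rw [h2] at h1
    have hdeg : (C ((p : K) ^ (e + (k + 1))) * (F * G).coeff b).degree < (p ^ k : ℕ) :=
      (degree_C_mul_lt _ (degree_coeff_mul_lt (hblock f) (hblock g) b)).trans_le
        (by exact_mod_cast hm)
    rw [← coeff_one_sub_root_mul_toCyclic hp.two_le hdeg hi, ← h1, sub_mul, one_mul,
      AddMonoidAlgebra.coeff_sub, Finsupp.sub_apply, mul_comm, coeff_mul_root]
  have hfg : C ((p : K) ^ (e + (k + 1))) * (f * g) = ∑ b ∈ Finset.range (n + n),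
      X ^ (m * b) * (C ((p : K) ^ (e + (k + 1))) * (F * G).coeff b) := by
    have h1 : (F * G).eval (X ^ m) = f * g := by
      rw [eval_mul, eval_blocks hf, eval_blocks hg]
    rw [← h1, eval, eval₂_eq_sum_of_degree_lt _ _ hFG, Finset.mul_sum]
    refine Finset.sum_congr rfl fun b _ => ?_
    rw [RingHom.id_apply, ← pow_mul]
    ring
  -- forward transforms, products of values, inverse transform, reading off, overlap of the blocks
  have c1 := ((hfft f).mono_left (S' := coeffSet f ∪ coeffSet g)
    (fun x hx => Or.inl (Or.inl hx))).union ((hfft g).mono_left (S' := coeffSet f ∪ coeffSet g)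
    (fun x hx => Or.inl (Or.inr hx)))
  have c2 := c1.trans' (S' := _) (Computes.biUnion_range q fun j _ =>
    h.computes_cyclic hp.ne_zero (u := dft q (fun b => toCyclic K q (F.coeff b)) 1 j)
      (v := dft q (fun b => toCyclic K q (G.coeff b)) 1 j)
      (fun x hx => Or.inl (Set.mem_iUnion.2 ⟨j, hx⟩))
      (fun x hx => Or.inr (Set.mem_iUnion.2 ⟨j, hx⟩)))
    (fun x hx => Or.inl (Or.inr hx))
  have c3 := c2.trans' (S' := _) (Computes.dft hp.ne_zero (k + 1) V (-1)
    (by rw [← hq, ZMod.natCast_self, zero_mul])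
    fun b hb x hx => Or.inl (Set.mem_iUnion₂.2 ⟨b, Finset.mem_range.2 hb, hx⟩))
    (fun x hx => Or.inl (Or.inr hx))
  have c4 := c3.trans' (S' := _) (Computes.biUnion_range (n + n)
    (t := fun b => coeffSet (C ((p : K) ^ (e + (k + 1))) * (F * G).coeff b)) fun b hb =>
      Computes.coeffSet (n := p ^ k) (c := 1)
        ((degree_C_mul_lt _ (degree_coeff_mul_lt (hblock f) (hblock g) b)).trans_le
          (by exact_mod_cast hm)) fun i hi => by
            rw [hW b (by omega) i hi]
            exact Computes.sub (Or.inl (Set.mem_iUnion.2 ⟨b, _, rfl⟩))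
              (Or.inl (Set.mem_iUnion.2 ⟨b, _, rfl⟩)))
    (fun x hx => Or.inl (Or.inr hx))
  have c5 := c4.trans' (S' := _) (Computes.sum_X_pow_mul
    (fun b => C ((p : K) ^ (e + (k + 1))) * (F * G).coeff b) (m := m) (n := n + n)
    (fun b _ => degree_C_mul_lt _ (degree_coeff_mul_lt (hblock f) (hblock g) b))
    fun b hb x hx => Or.inl (Set.mem_iUnion₂.2 ⟨b, Finset.mem_range.2 hb, hx⟩))
    (fun x hx => Or.inl (Or.inr hx))
  rw [hfg]
  refine c5.mono_cost ?_
  have e1 : (k + 1) * p ^ (k + 1 + 1) * q = (k + 1) * p * q ^ 2 := by rw [hq]; ring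
  rw [← hq, e1]
  have e2 : (n + n) * (p ^ k * 1) ≤ q ^ 2 := by
    rw [pow_two, mul_one]
    exact Nat.mul_le_mul hn hMq
  have e3 : m * (n + n) + m ≤ q ^ 2 := by
    calc m * (n + n) + m = m * (n + n + 1) := by ring
      _ ≤ m * (q + 1) := Nat.mul_le_mul_left _ (by omega)
      _ = m * q + m := by ring
      _ ≤ m * q + m * q := Nat.add_le_add_left (Nat.le_mul_of_pos_right _ hq0) _
      _ = (m + m) * q := by ring
      _ ≤ q * q := Nat.mul_le_mul_right _ (by omega)
      _ = q ^ 2 := by ring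
  nlinarith

end ScaledMul

theorem Nat.size_eq_size_div_two_add_one {u : ℕ} (hu : u ≠ 0) : u.size = (u / 2).size + 1 := by
  conv_lhs => rw [← Nat.bit_bodd_div2 u]
  rw [Nat.size_bit (by rwa [Nat.bit_bodd_div2]), Nat.div2_val]

theorem Nat.two_pow_size_le (u : ℕ) : 2 ^ u.size ≤ 2 * u + 1 := by
  rcases Nat.eq_zero_or_pos u with rfl | hu
  · simp
  · have h1 : u.size - 1 < u.size := by
      have := Nat.size_pos.2 hu
      omega
    have h2 := Nat.lt_size.1 h1
    calc 2 ^ u.size = 2 ^ (u.size - 1 + 1) := by congr 1; omega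
      _ = 2 * 2 ^ (u.size - 1) := by ring
      _ ≤ 2 * u + 1 := by omega

section FullMul

variable {K : Type*} [CommRing K]

/-- The solution of the recursion `T k ≤ p ^ κ * T κ + O (κ * p ^ (2 * κ))` with `κ = k / 2 + 2`.
The exponent `κ - 4` is at most half of `k - 4`, so that the number of binary digits of `k - 4`
counts the levels; each of them multiplies `T k / p ^ k` by a constant. -/
theorem ScaledMul.exists_cost_le {p : ℕ} (hp : p.Prime) (k : ℕ) :
    ∃ e ≤ 5 * k, ScaledMul K p k e
      ((8 * p ^ 4 + 15 * p + 3) * p ^ k * (2 * p ^ 4) ^ (k - 4).size) := by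
  induction k using Nat.strong_induction_on with
  | _ k ih =>
  -- for `k ≤ 4` the exponent `k / 2 + 2` would not be smaller than `k`
  rcases Nat.lt_or_ge k 5 with hk | hk
  · refine ⟨0, Nat.zero_le _, (ScaledMul.schoolbook p k).mono ?_⟩
    rw [show k - 4 = 0 by omega, Nat.size_zero, pow_zero, mul_one, pow_two, ← mul_assoc]
    refine Nat.mul_le_mul_right _ ?_
    have : p ^ k ≤ p ^ 4 := Nat.pow_le_pow_right hp.pos (by omega)
    omega
  · obtain ⟨e, he, h⟩ := ih (k / 2 + 1 + 1) (by omega)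
    have hp2 := hp.two_le
    have hm : p ^ (k / 2) + p ^ (k / 2) ≤ p ^ (k / 2 + 1) := by
      rw [pow_succ, ← mul_two]
      exact Nat.mul_le_mul_left _ hp2
    have hn : p ^ (k - k / 2) + p ^ (k - k / 2) ≤ p ^ (k / 2 + 1 + 1) := by
      calc p ^ (k - k / 2) + p ^ (k - k / 2) ≤ p ^ (k / 2 + 1) + p ^ (k / 2 + 1) :=
            Nat.add_le_add (Nat.pow_le_pow_right hp.pos (by omega))
              (Nat.pow_le_pow_right hp.pos (by omega))
        _ ≤ p ^ (k / 2 + 1 + 1) := by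
            rw [pow_succ _ (k / 2 + 1), ← mul_two]
            exact Nat.mul_le_mul_left _ hp2
    have hmn : p ^ (k / 2) * p ^ (k - k / 2) = p ^ k := by
      rw [← pow_add]
      congr 1
      omega
    refine ⟨e + (k / 2 + 1 + 1), by omega, fun f g hf hg => ?_⟩
    rw [← hmn] at hf hg
    refine (h.computes_mul hp hm hn hf hg).mono_cost ?_
    have hsize : (k - 4).size = (k / 2 + 1 + 1 - 4).size + 1 := by
      rw [Nat.size_eq_size_div_two_add_one (by omega)]
      congr 2
      omega
    rw [hsize]
    set s := (k / 2 + 1 + 1 - 4).size with hs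
    have hκ : k / 2 + 1 + 1 ≤ 5 * (2 * p ^ 4) ^ s := by
      have h1 : k / 2 + 1 + 1 - 4 < 2 ^ s := Nat.lt_size_self _
      have h2 : 2 ^ s ≤ (2 * p ^ 4) ^ s :=
        Nat.pow_le_pow_left (Nat.le_mul_of_pos_right _ (pow_pos hp.pos _)) _
      omega
    have hq : (p ^ (k / 2 + 1 + 1)) ^ 2 ≤ p ^ k * p ^ 4 := by
      rw [← pow_mul, ← pow_add]
      exact Nat.pow_le_pow_right hp.pos (by omega)
    set B := (2 * p ^ 4) ^ s with hB
    have hB1 : 1 ≤ B := Nat.one_le_iff_ne_zero.2 (pow_ne_zero _ (by positivity))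
    set q := p ^ (k / 2 + 1 + 1) with hqdef
    have h3 : 3 * (k / 2 + 1 + 1) * p + 3 ≤ (8 * p ^ 4 + 15 * p + 3) * B := by
      have : 3 * (k / 2 + 1 + 1) * p ≤ 3 * (5 * B) * p :=
        Nat.mul_le_mul_right _ (Nat.mul_le_mul_left _ hκ)
      nlinarith [Nat.zero_le (p ^ 4 * B)]
    calc q * ((8 * p ^ 4 + 15 * p + 3) * q * B) + (3 * (k / 2 + 1 + 1) * p + 3) * q ^ 2
        = ((8 * p ^ 4 + 15 * p + 3) * B + (3 * (k / 2 + 1 + 1) * p + 3)) * q ^ 2 := by ring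
      _ ≤ ((8 * p ^ 4 + 15 * p + 3) * B + (8 * p ^ 4 + 15 * p + 3) * B) * (p ^ k * p ^ 4) :=
          Nat.mul_le_mul (Nat.add_le_add_left h3 _) hq
      _ = (8 * p ^ 4 + 15 * p + 3) * p ^ k * (2 * p ^ 4) ^ (s + 1) := by
          rw [pow_succ _ s, ← hB]
          ring

/-! ### Quasi-linear multiplication over an arbitrary commutative ring -/

theorem exists_bezout_two_three (a b : ℕ) :
    ∃ u v : ℕ, u * 2 ^ a = v * 3 ^ b + 1 ∧ u ≤ 3 ^ b ∧ v ≤ 2 ^ a := by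
  rcases Nat.eq_zero_or_pos b with rfl | hb
  · refine ⟨1, 2 ^ a - 1, ?_, by simp, Nat.sub_le _ _⟩
    have : 0 < 2 ^ a := by positivity
    simp
    omega
  · have hco : Nat.Coprime (2 ^ a) (3 ^ b) := Nat.Coprime.pow _ _ (by norm_num)
    obtain ⟨u, hu, hu1⟩ :=
      Nat.exists_mul_mod_eq_one_of_coprime hco (Nat.one_lt_pow hb.ne' (by norm_num))
    refine ⟨u, 2 ^ a * u / 3 ^ b, ?_, hu.le, ?_⟩
    · have := Nat.div_add_mod (2 ^ a * u) (3 ^ b)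
      rw [hu1] at this
      linarith
    · exact Nat.div_le_of_le_mul (by nlinarith [Nat.zero_le (2 ^ a)])

/-- Scaling all coefficients by a known element. -/
theorem Computes.C_mul {S : Set K} {n : ℕ} {f : K[X]} {a : K} (hf : f.degree < n)
    (hS : _root_.coeffSet f ⊆ S) (ha : a ∈ S) : Computes S n (_root_.coeffSet (C a * f)) := by
  refine (Computes.coeffSet (c := 1) (degree_C_mul_lt a hf) fun j _ => ?_).mono_cost (by omega)
  rw [coeff_C_mul]
  exact Computes.mul (Or.inl ha) (Or.inl (hS ⟨j, rfl⟩))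

/-- The trick of Cantor and Kaltofen: the product is an integral linear combination of its
multiples by a power of two and by a power of three. -/
theorem ScaledMul.computes_mul_of_two_three {k₂ k₃ a b t₂ t₃ : ℕ} (h₂ : ScaledMul K 2 k₂ a t₂)
    (h₃ : ScaledMul K 3 k₃ b t₃) {n : ℕ} (hn₂ : n ≤ 2 ^ k₂) (hn₃ : n ≤ 3 ^ k₃) {f g : K[X]}
    (hf : f.degree < n) (hg : g.degree < n) :
    Computes (coeffSet f ∪ coeffSet g) (t₂ + t₃ + (4 * b + 2 * a + 4) + 6 * n)
      (coeffSet (f * g)) := by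
  obtain ⟨u, v, huv, hu, hv⟩ := exists_bezout_two_three a b
  have hn₂' : (n : WithBot ℕ) ≤ (2 ^ k₂ : ℕ) := by exact_mod_cast hn₂
  have hn₃' : (n : WithBot ℕ) ≤ (3 ^ k₃ : ℕ) := by exact_mod_cast hn₃
  have hfg := degree_mul_lt_add hf hg
  set P₂ := C (((2 : ℕ) : K) ^ a) * (f * g) with hP₂
  set P₃ := C (((3 : ℕ) : K) ^ b) * (f * g) with hP₃
  have key : f * g = C (u : K) * P₂ - C (v : K) * P₃ := by
    have h1 : (u : K) * 2 ^ a = v * 3 ^ b + 1 := by exact_mod_cast congrArg (Nat.cast (R := K)) huv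
    have h2 := congrArg (C : K → K[X]) h1
    rw [C_mul, C_add, C_mul, C_1] at h2
    rw [hP₂, hP₃]
    push_cast
    linear_combination (-(f * g)) * h2
  have c1 := (h₂ f g (hf.trans_le hn₂') (hg.trans_le hn₂')).union
    (h₃ f g (hf.trans_le hn₃') (hg.trans_le hn₃'))
  have hsu : 2 * u.size ≤ 4 * b + 2 := by
    have : u.size ≤ 2 * b + 1 := Nat.size_le.2 (by
      calc u ≤ 3 ^ b := hu
        _ ≤ 4 ^ b := Nat.pow_le_pow_left (by norm_num) b
        _ = 2 ^ (2 * b) := by rw [pow_mul]; norm_num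
        _ < 2 ^ (2 * b + 1) := Nat.pow_lt_pow_right (by norm_num) (by omega))
    omega
  have hsv : 2 * v.size ≤ 2 * a + 2 := by
    have : v.size ≤ a + 1 := Nat.size_le.2
      (hv.trans_lt (Nat.pow_lt_pow_right (by norm_num) (by omega)))
    omega
  have c2 := c1.union ((Computes.natCast (coeffSet f ∪ coeffSet g) u).union
    (Computes.natCast (coeffSet f ∪ coeffSet g) v))
  have d₂ : P₂.degree < (n + n : ℕ) := degree_C_mul_lt _ hfg
  have d₃ : P₃.degree < (n + n : ℕ) := degree_C_mul_lt _ hfg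
  let V : Set K := coeffSet P₂ ∪ coeffSet P₃ ∪ ({(u : K)} ∪ {(v : K)})
  have e₂ : Computes V (n + n) (coeffSet (C (u : K) * P₂)) :=
    Computes.C_mul d₂ (fun x hx => Or.inl (Or.inl hx)) (Or.inr (Or.inl rfl))
  have e₃ : Computes V (n + n) (coeffSet (C (v : K) * P₃)) :=
    Computes.C_mul d₃ (fun x hx => Or.inl (Or.inr hx)) (Or.inr (Or.inr rfl))
  have c3 := c2.trans' (e₂.union e₃) (fun x hx => Or.inl (Or.inr hx))
  have c4 := c3.trans' (Computes.sub_poly (degree_C_mul_lt (u : K) d₂) (degree_C_mul_lt (v : K) d₃))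
    (fun x hx => Or.inl (Or.inr hx))
  rw [key]
  exact c4.mono_cost (by omega)

/-- Multiplication with `O (n * log n ^ 8)` operations over every commutative ring. The exponent
comes from the factor `2 * p ^ 4 < 2 ^ 8` per level of the recursion, for `p = 2` and `p = 3`. -/
theorem exists_computes_mul :
    ∃ c : ℕ, ∀ (K : Type*) [CommRing K] (n : ℕ) (f g : K[X]), f.degree < n → g.degree < n →
      Computes (coeffSet f ∪ coeffSet g) (c * n * Nat.log 2 (n + 2) ^ 8) (coeffSet (f * g)) := by
  -- `2410 = 2 * (8 * 2 ^ 4 + 15 * 2 + 3) + 3 * (8 * 3 ^ 4 + 15 * 3 + 3)`, the factors `2` and `3`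
  -- being the loss in rounding `n` up to powers of `2` and `3`
  refine ⟨2410 * 5 ^ 8 + 74, fun K _ n f g hf hg => ?_⟩
  rcases Nat.eq_zero_or_pos n with rfl | hn
  · have hf0 : f = 0 := by
      rw [← degree_eq_bot]
      exact Nat.WithBot.lt_zero_iff.1 hf
    refine .subset ?_
    rintro _ ⟨j, rfl⟩
    exact Or.inr (by simp [hf0])
  set l := Nat.log 2 (n + 2) with hl
  have hl1 : 1 ≤ l := Nat.le_log_of_pow_le (by norm_num) (by omega)
  have hclog : ∀ p, 2 ≤ p → Nat.clog p n ≤ 2 * l := by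
    intro p hp
    calc Nat.clog p n ≤ Nat.clog 2 n := Nat.clog_anti_left (by norm_num) hp
      _ ≤ l + 1 := Nat.clog_le_of_le_pow (by
          have := Nat.lt_pow_succ_log_self (b := 2) (by norm_num) (n + 2)
          rw [← hl] at this
          exact (by omega : n ≤ n + 2).trans this.le)
      _ ≤ 2 * l := by omega
  have hpow : ∀ p, 2 ≤ p → p ^ Nat.clog p n ≤ p * n := by
    intro p hp
    rcases Nat.lt_or_ge 1 n with h1 | h1
    · have h2 := Nat.pow_pred_clog_lt_self (b := p) (by omega) h1
      have h3 := Nat.clog_pos (b := p) (by omega) h1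
      calc p ^ Nat.clog p n = p * p ^ (Nat.clog p n).pred := by
            rw [← pow_succ']
            congr 1
            exact (Nat.succ_pred_eq_of_pos h3).symm
        _ ≤ p * n := Nat.mul_le_mul_left _ h2.le
    · rw [Nat.clog_of_right_le_one h1, pow_zero]
      exact Nat.mul_pos (by omega) hn
  have hB : ∀ p, 2 ≤ p → p ≤ 3 → (2 * p ^ 4) ^ (Nat.clog p n - 4).size ≤ 5 ^ 8 * l ^ 8 := by
    intro p hp hp3
    calc (2 * p ^ 4) ^ (Nat.clog p n - 4).size ≤ (2 ^ 8) ^ (Nat.clog p n - 4).size :=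
          Nat.pow_le_pow_left (by interval_cases p <;> norm_num) _
      _ = (2 ^ (Nat.clog p n - 4).size) ^ 8 := by rw [← pow_mul, ← pow_mul, mul_comm]
      _ ≤ (5 * l) ^ 8 := Nat.pow_le_pow_left ((Nat.two_pow_size_le _).trans (by
          have := hclog p hp
          omega)) _
      _ = 5 ^ 8 * l ^ 8 := by rw [mul_pow]
  obtain ⟨a, ha, h₂⟩ := ScaledMul.exists_cost_le (K := K) Nat.prime_two (Nat.clog 2 n)
  obtain ⟨b, hb, h₃⟩ := ScaledMul.exists_cost_le (K := K) Nat.prime_three (Nat.clog 3 n)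
  refine (h₂.computes_mul_of_two_three h₃ (Nat.le_pow_clog (by norm_num) n)
    (Nat.le_pow_clog (by norm_num) n) hf hg).mono_cost ?_
  have t₂ := Nat.mul_le_mul (hpow 2 (by norm_num)) (hB 2 (by norm_num) (by norm_num))
  have t₃ := Nat.mul_le_mul (hpow 3 (by norm_num)) (hB 3 (by norm_num) (by norm_num))
  have hla := hclog 2 (by norm_num)
  have hlb := hclog 3 (by norm_num)
  have hll : l ≤ l ^ 8 := Nat.le_self_pow (by norm_num) l
  have hnl : l ^ 8 ≤ n * l ^ 8 := Nat.le_mul_of_pos_left _ hn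
  have hnl' : n ≤ n * l ^ 8 := Nat.le_mul_of_pos_right _ (by omega)
  generalize l ^ 8 = L at *
  generalize (2 * 2 ^ 4) ^ (Nat.clog 2 n - 4).size = B₂ at *
  generalize (2 * 3 ^ 4) ^ (Nat.clog 3 n - 4).size = B₃ at *
  generalize 2 ^ Nat.clog 2 n = Q₂ at *
  generalize 3 ^ Nat.clog 3 n = Q₃ at *
  norm_num at *
  nlinarith

end FullMul

/-! ### Taylor shifts -/

section FastArithmetic

variable {K : Type*} [CommRing K] {N μ : ℕ}

/-- Over `K`, polynomials of degrees less than `n` can be multiplied with `μ * n` operations for all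
`n ≤ N`. -/
def MulBound (K : Type*) [CommRing K] (N μ : ℕ) : Prop :=
  1 ≤ μ ∧ ∀ n ≤ N, ∀ f g : K[X], f.degree < n → g.degree < n →
    Computes (coeffSet f ∪ coeffSet g) (μ * n) (coeffSet (f * g))

theorem MulBound.computes_mul (hM : MulBound K N μ) {n : ℕ} (hn : n ≤ N) {f g : K[X]}
    (hf : f.degree < n) (hg : g.degree < n) {S : Set K} (hfS : coeffSet f ⊆ S ∪ {0, 1})
    (hgS : coeffSet g ⊆ S ∪ {0, 1}) : Computes S (μ * n) (coeffSet (f * g)) :=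
  (hM.2 n hn f g hf hg).mono_left (Set.union_subset hfS hgS)

theorem coeffSet_C_subset (a : K) : coeffSet (C a) ⊆ {a} ∪ {0, 1} := by
  rintro _ ⟨i, rfl⟩
  rw [coeff_C]
  split_ifs
  · exact Or.inl rfl
  · exact Or.inr (by simp)

theorem coeffSet_X_add_C_subset (a : K) : coeffSet (X + C a) ⊆ {a} ∪ {0, 1} := by
  rintro _ ⟨i, rfl⟩
  rcases i with _ | _ | i
  · simp
  · simp [coeff_X]
  · simp [coeff_X]

theorem degree_X_add_C_pow_lt (a : K) (m : ℕ) :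
    ((X + C a) ^ m).degree < ((m + 1 : ℕ) : WithBot ℕ) := by
  rw [degree_lt_iff_coeff_zero]
  intro i hi
  refine coeff_eq_zero_of_natDegree_lt (lt_of_le_of_lt ?_ (Nat.lt_of_succ_le hi))
  refine natDegree_pow_le.trans ?_
  calc m * (X + C a).natDegree ≤ m * 1 := Nat.mul_le_mul_left _ (by compute_degree)
    _ = m := mul_one m

theorem degree_lt_of_lt_of_le {f : K[X]} {m n : ℕ} (hf : f.degree < m) (h : m ≤ n) :
    f.degree < n :=
  hf.trans_le (by exact_mod_cast h)

/-- Powers of `X + a` by repeated squaring. -/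
theorem MulBound.computes_X_add_C_pow (hM : MulBound K N μ) (a : K) (m : ℕ) (hm : m ≤ N) :
    Computes {a} (4 * μ * m) (coeffSet ((X + C a) ^ m)) := by
  induction m using Nat.strong_induction_on with
  | _ m ih =>
  rcases Nat.lt_or_ge m 2 with h | h
  · interval_cases m
    · refine .subset ?_
      rw [pow_zero, ← C_1]
      refine (coeffSet_C_subset _).trans ?_
      simp [Set.subset_def]
    · rw [pow_one]
      exact .subset (coeffSet_X_add_C_subset a)
  · have h1 := ih (m / 2) (by omega) (by omega)
    have h2 := degree_X_add_C_pow_lt a (m / 2)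
    have c1 := h1.trans (hM.computes_mul (by omega) h2 h2 (Set.subset_union_right.trans
      Set.subset_union_left) (Set.subset_union_right.trans Set.subset_union_left))
    have h3 : μ * (m / 2 + 1) ≤ μ * m := Nat.mul_le_mul_left _ (by omega)
    have h4 : μ * (2 * (m / 2)) ≤ μ * m := Nat.mul_le_mul_left _ (by omega)
    rw [← pow_add] at c1
    rcases Nat.even_or_odd' m with ⟨k, hk | hk⟩
    · rw [show m / 2 + m / 2 = m by omega] at c1
      exact c1.mono_cost (by nlinarith)
    · have h5 : (X + C a : K[X]).degree < m := by
        have := degree_X_add_C_pow_lt a 1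
        rw [pow_one] at this
        exact degree_lt_of_lt_of_le this h
      have c2 := c1.trans (hM.computes_mul hm
        (degree_lt_of_lt_of_le (degree_X_add_C_pow_lt a (m / 2 + m / 2)) (by omega)) h5
        (Set.subset_union_right.trans Set.subset_union_left)
        ((coeffSet_X_add_C_subset a).trans
          (Set.union_subset_union_left _ Set.subset_union_left)))
      rw [← pow_succ, show m / 2 + m / 2 + 1 = m by omega] at c2
      exact c2.mono_cost (by nlinarith)

theorem taylor_of_degree_lt_one (a : K) {f : K[X]} (hf : f.degree < (1 : ℕ)) :
    taylor a f = f := by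
  rw [← window_zero_of_degree_lt hf]
  simp [window]

/-- The Taylor shift by divide and conquer: with `f = f₀ + X ^ m * f₁`, both halves are shifted and
`(X + a) ^ m` is multiplied to the second one. -/
theorem MulBound.computes_taylor (hM : MulBound K N μ) (a : K) (s n : ℕ) (hs : n ≤ 2 ^ s)
    (hn : n ≤ N) {f : K[X]} (hf : f.degree < n) :
    Computes (coeffSet f ∪ {a}) (s * (5 * μ * n)) (coeffSet (taylor a f)) := by
  have hμ := hM.1
  induction s generalizing n f with
  | zero =>
    have h1 : f.degree < (1 : ℕ) := degree_lt_of_lt_of_le hf (by simpa using hs)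
    rw [taylor_of_degree_lt_one a h1]
    exact .of_subset Set.subset_union_left
  | succ s ih =>
    rcases Nat.lt_or_ge n 2 with h | h
    · exact (ih n ((Nat.le_of_lt_succ h).trans Nat.one_le_two_pow) hn hf).mono_cost
        (Nat.mul_le_mul_right _ (by omega))
    · rw [pow_succ] at hs
      have d₀ := degree_window_lt f 0 (n / 2)
      have d₁ := degree_window_lt f (n / 2) (n - n / 2)
      have hS : ∀ u v, coeffSet (window f u v) ∪ {a} ⊆ coeffSet f ∪ {a} ∪ {0, 1} := fun u v =>
        Set.union_subset ((coeffSet_window_subset f u v).trans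
          (Set.union_subset_union_left _ Set.subset_union_left))
          (Set.subset_union_right.trans Set.subset_union_left)
      have c₀ := (ih (n / 2) (by omega) (by omega) d₀).mono_left (hS _ _)
      have c₁ := (ih (n - n / 2) (by omega) (by omega) d₁).mono_left (hS _ _)
      have c₂ := (hM.computes_X_add_C_pow a (n / 2) (by omega)).mono_left
        (S' := coeffSet f ∪ {a}) (Set.subset_union_right.trans Set.subset_union_left)
      rw [← degree_taylor _ a] at d₀ d₁
      have d₂ := degree_X_add_C_pow_lt a (n / 2)
      have c₃ := ((c₀.union c₁).union c₂).trans_union (hM.computes_mul hn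
        (degree_lt_of_lt_of_le d₂ (by omega)) (degree_lt_of_lt_of_le d₁ (by omega))
        (fun x hx => Or.inl (Or.inr (Or.inr hx)))
        (fun x hx => Or.inl (Or.inr (Or.inl (Or.inr hx)))))
      have d₃ := degree_lt_of_lt_of_le (degree_mul_lt_add d₂ d₁) (show _ ≤ n + 1 by omega)
      have c₄ := c₃.trans' (Computes.add_poly
        (degree_lt_of_lt_of_le d₀ (show n / 2 ≤ n + 1 by omega)) d₃) (by
          rintro x (hx | hx)
          · exact Or.inl (Or.inr (Or.inl (Or.inl (Or.inl hx))))
          · exact Or.inl (Or.inr (Or.inr hx)))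
      have heq : taylor a f = taylor a (window f 0 (n / 2)) +
          (X + C a) ^ (n / 2) * taylor a (window f (n / 2) (n - n / 2)) := by
        have h3 := window_add_X_pow_mul_window 0 (n - n / 2) (n / 2) f
        rw [zero_add, Nat.add_sub_cancel' (by omega), window_zero_of_degree_lt hf] at h3
        conv_lhs => rw [← h3]
        rw [map_add, taylor_mul, taylor_X_pow]
      rw [heq]
      refine c₄.mono_cost ?_
      have h4 : n ≤ μ * n := Nat.le_mul_of_pos_left n hμ
      have h5 : 4 * μ * (n / 2) ≤ 2 * (μ * n) := by
        calc 4 * μ * (n / 2) = 2 * (μ * (2 * (n / 2))) := by ring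
          _ ≤ 2 * (μ * n) := Nat.mul_le_mul_left _ (Nat.mul_le_mul_left _ (by omega))
      have h6 : s * (5 * μ * (n / 2)) + s * (5 * μ * (n - n / 2)) = s * (5 * μ * n) := by
        rw [← mul_add, ← mul_add, Nat.add_sub_cancel' (by omega)]
      have h7 : (s + 1) * (5 * μ * n) = s * (5 * μ * n) + 5 * (μ * n) := by ring
      omega

/-! ### Division with remainder -/

theorem exists_window_eq_sub (f : K[X]) (t : ℕ) : ∃ g, window f 0 t = f - X ^ t * g := by
  have h : X ^ t ∣ f - window f 0 t := by
    rw [X_pow_dvd_iff]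
    intro i hi
    rw [coeff_sub, coeff_window, if_pos hi, zero_add, sub_self]
  obtain ⟨g, hg⟩ := h
  exact ⟨g, by rw [← hg]; ring⟩

/-- Inversion of power series with constant coefficient `1` by Newton's iteration
`h ↦ 2 * h - h ^ 2 * f`, which doubles the precision. -/
theorem MulBound.exists_computes_inverse (hM : MulBound K N μ) {f : K[X]} (hf : f.coeff 0 = 1)
    (t : ℕ) (ht : t ≤ N) :
    ∃ h : K[X], h.degree < t ∧ X ^ t ∣ h * f - 1 ∧
      Computes (coeffSet f) (16 * μ * t) (coeffSet h) := by
  have hμ := hM.1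
  induction t using Nat.strong_induction_on with
  | _ t ih =>
  -- for `t ≥ 2` the precision `(t + 1) / 2` is at most `3 / 4 * t`, so the costs
  -- add up geometrically
  rcases Nat.lt_or_ge t 2 with h2 | h2
  · interval_cases t
    · refine ⟨0, by simp, by simp, .subset ?_⟩
      rintro _ ⟨i, rfl⟩
      exact Or.inr (by simp)
    · refine ⟨C 1, degree_C_le.trans_lt (by norm_num), ?_, .subset ?_⟩
      · rw [pow_one, X_dvd_iff]
        simp [hf]
      · refine (coeffSet_C_subset _).trans ?_
        simp [Set.subset_def]
  · obtain ⟨h, hdeg, hdvd, hc⟩ := ih ((t + 1) / 2) (by omega) (by omega)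
    have hdeg' := degree_lt_of_lt_of_le hdeg (show (t + 1) / 2 ≤ t by omega)
    have c₁ := hc.trans_union (hM.computes_mul ht hdeg' (degree_window_lt f 0 t)
      (Set.subset_union_right.trans Set.subset_union_left)
      ((coeffSet_window_subset _ _ _).trans (Set.union_subset_union_left _ Set.subset_union_left)))
    have c₂ := c₁.trans_union (hM.computes_mul ht hdeg'
      (degree_window_lt (h * window f 0 t) 0 t) (fun x hx => Or.inl (Or.inr (Or.inl hx)))
      ((coeffSet_window_subset _ _ _).trans (Set.union_subset_union_left _
        (fun x hx => Or.inr (Or.inr hx)))))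
    have c₃ := c₂.trans_union ((Computes.add_poly hdeg' hdeg').mono_left (by
      rintro x (hx | hx) <;> exact Or.inl (Or.inr (Or.inl (Or.inl hx)))))
    have d₁ : (h + h).degree < t := (degree_add_le h h).trans_lt (max_lt hdeg' hdeg')
    have d₂ := degree_window_lt (h * window (h * window f 0 t) 0 t) 0 t
    have c₄ := c₃.trans' (Computes.sub_poly d₁ d₂) (Set.union_subset
      (fun x hx => Or.inl (Or.inr (Or.inr hx)))
      ((coeffSet_window_subset _ _ _).trans (Set.union_subset_union_left _
        (fun x hx => Or.inr (Or.inl (Or.inr hx))))))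
    refine ⟨_, (degree_sub_le _ _).trans_lt (max_lt d₁ d₂), ?_, c₄.mono_cost ?_⟩
    · obtain ⟨r₁, h₁⟩ := exists_window_eq_sub f t
      obtain ⟨r₂, h₂⟩ := exists_window_eq_sub (h * window f 0 t) t
      obtain ⟨r₃, h₃⟩ := exists_window_eq_sub (h * window (h * window f 0 t) 0 t) t
      have h₄ : X ^ t ∣ (h * f - 1) ^ 2 := by
        refine (pow_dvd_pow X (show t ≤ (t + 1) / 2 * 2 by omega)).trans ?_
        rw [pow_mul]
        exact pow_dvd_pow_of_dvd hdvd 2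
      have h₅ : (h + h - window (h * window (h * window f 0 t) 0 t) 0 t) * f - 1 =
          X ^ t * ((h ^ 2 * r₁ + h * r₂ + r₃) * f) - (h * f - 1) ^ 2 := by
        rw [h₃, h₂, h₁]
        ring
      rw [h₅]
      exact dvd_sub (dvd_mul_right _ _) h₄
    · have h4 : t ≤ μ * t := Nat.le_mul_of_pos_left t hμ
      have h5 : 16 * μ * ((t + 1) / 2) ≤ 12 * (μ * t) := by
        calc 16 * μ * ((t + 1) / 2) = 4 * (μ * (4 * ((t + 1) / 2))) := by ring
          _ ≤ 4 * (μ * (3 * t)) := Nat.mul_le_mul_left _ (Nat.mul_le_mul_left _ (by omega))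
          _ = 12 * (μ * t) := by ring
      have h6 : 16 * μ * t = 16 * (μ * t) := by ring
      omega

theorem coeffSet_reflect_subset (n : ℕ) (f : K[X]) : coeffSet (reflect n f) ⊆ coeffSet f := by
  rintro _ ⟨i, rfl⟩
  exact ⟨_, (coeff_reflect n f i).symm⟩

/-- Division with remainder: the reversed quotient is the reversed dividend times the inverse of the
reversed divisor, up to a power of `X` that exceeds the degree of the quotient. -/
theorem MulBound.computes_modByMonic [Nontrivial K] (hM : MulBound K N μ) {n : ℕ} (hn : n + 1 ≤ N)
    {f g : K[X]} (hf : f.natDegree ≤ n) (hg : g.Monic) :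
    Computes (coeffSet f ∪ coeffSet g) (19 * μ * (n + 1)) (coeffSet (f %ₘ g)) := by
  have hμ := hM.1
  rcases Nat.lt_or_ge n g.natDegree with h | h
  · rw [(modByMonic_eq_self_iff hg).2 (degree_lt_degree (by omega))]
    exact .of_subset Set.subset_union_left
  set d := g.natDegree with hd
  set t := n - d + 1 with ht
  obtain ⟨v, hv, hdvd, hc⟩ := hM.exists_computes_inverse (f := reflect d g)
    (by rw [coeff_reflect, revAt_zero]; exact hg) t (by omega)
  set u := f /ₘ g with hu
  set r := f %ₘ g with hr
  have hur : r + g * u = f := modByMonic_add_div f g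
  have hudeg : u.natDegree ≤ n - d := by
    rw [hu, natDegree_divByMonic f hg]
    omega
  have hrdeg : r.degree < (d : ℕ) := by
    rw [hd, ← degree_eq_natDegree hg.ne_zero]
    exact degree_modByMonic_lt f hg
  have hrefl : reflect n f = reflect n r + reflect d g * reflect (n - d) u := by
    rw [← reflect_mul g u le_rfl hudeg, ← hur, reflect_add]
    congr 2
    omega
  have hrX : X ^ t ∣ reflect n r := by
    rw [X_pow_dvd_iff]
    intro i hi
    rw [coeff_reflect, revAt_le (by omega)]
    exact (degree_lt_iff_coeff_zero r d).1 hrdeg _ (by omega)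
  -- the reversed quotient
  set w := window (window (reflect n f) 0 t * v) 0 t with hw
  have hwu : w = reflect (n - d) u := by
    obtain ⟨r₁, h₁⟩ := exists_window_eq_sub (reflect n f) t
    have h₂ : X ^ t ∣ window (reflect n f) 0 t * v - reflect (n - d) u := by
      have : window (reflect n f) 0 t * v - reflect (n - d) u =
          (v * reflect d g - 1) * reflect (n - d) u + reflect n r * v - X ^ t * (r₁ * v) := by
        rw [h₁, hrefl]
        ring
      rw [this]
      exact dvd_sub (dvd_add (hdvd.mul_right _) (hrX.mul_right _)) (dvd_mul_right _ _)
    rw [X_pow_dvd_iff] at h₂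
    ext i
    rw [hw, coeff_window]
    split_ifs with hi
    · rw [zero_add]
      exact sub_eq_zero.1 (by rw [← coeff_sub]; exact h₂ i hi)
    · rw [coeff_reflect, revAt_eq_self_of_lt (by omega)]
      exact (coeff_eq_zero_of_natDegree_lt (by omega)).symm
  have huw : coeffSet u ⊆ coeffSet (window (reflect n f) 0 t * v) ∪ {0, 1} := by
    have : u = reflect (n - d) w := by rw [hwu, reflect_reflect]
    rw [this]
    exact (coeffSet_reflect_subset _ _).trans (coeffSet_window_subset _ _ _)
  have c₁ := (hc.mono_left (S' := coeffSet f ∪ coeffSet g) ((coeffSet_reflect_subset d g).trans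
    (Set.subset_union_right.trans Set.subset_union_left)))
  have c₂ := c₁.trans (hM.computes_mul (by omega : t ≤ N) (degree_window_lt (reflect n f) 0 t) hv
    ((coeffSet_window_subset _ _ _).trans (Set.union_subset_union_left _
      ((coeffSet_reflect_subset n f).trans (Set.subset_union_left.trans Set.subset_union_left))))
    (Set.subset_union_right.trans Set.subset_union_left))
  have hlt : ∀ {p : K[X]}, p.natDegree ≤ n → p.degree < (n + 1 : ℕ) := fun {p} hp =>
    degree_le_natDegree.trans_lt (by exact_mod_cast Nat.lt_succ_of_le hp)
  have c₃ := c₂.trans (hM.computes_mul hn (hlt (p := g) h) (hlt (p := u) (by omega))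
    (fun x hx => Or.inl (Or.inl (Or.inr hx))) (huw.trans (Set.union_subset_union_left _
      Set.subset_union_right)))
  have c₄ := c₃.trans (Computes.coeffSet (f := r) (n := n + 1) (c := 1)
    (degree_lt_of_lt_of_le hrdeg (by omega)) fun j _ => by
      have : r.coeff j = f.coeff j - (g * u).coeff j := by
        rw [← hur, coeff_add, add_sub_cancel_right]
      rw [this]
      exact Computes.sub (Or.inl (Or.inl (Or.inl ⟨j, rfl⟩))) (Or.inl (Or.inr ⟨j, rfl⟩)))
  refine c₄.mono_cost ?_
  have h1 : μ * t ≤ μ * (n + 1) := Nat.mul_le_mul_left _ (by omega)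
  have h2 : n + 1 ≤ μ * (n + 1) := Nat.le_mul_of_pos_left _ hμ
  have h3 : 16 * μ * t = 16 * (μ * t) := by ring
  have h4 : 19 * μ * (n + 1) = 19 * (μ * (n + 1)) := by ring
  omega

/-! ### Simultaneous remainders -/

/-- The coefficients of all polynomials of a list. -/
def listCoeffs (L : List K[X]) : Set K := {x | ∃ g ∈ L, x ∈ coeffSet g}

theorem listCoeffs_append (L₁ L₂ : List K[X]) :
    listCoeffs (L₁ ++ L₂) = listCoeffs L₁ ∪ listCoeffs L₂ := by
  ext x
  simp only [listCoeffs, List.mem_append, Set.mem_ofPred_eq, Set.mem_union]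
  grind

theorem coeffSet_subset_listCoeffs {L : List K[X]} {g : K[X]} (hg : g ∈ L) :
    coeffSet g ⊆ listCoeffs L := fun _ hx => ⟨g, hg, hx⟩

/-- Induction along balanced splittings of a list of length at most `2 ^ s`. -/
theorem List.balanced_induction {α : Type*} {P : ℕ → List α → Prop} (nil : ∀ s, P s [])
    (singleton : ∀ s a, P s [a])
    (append : ∀ s L₁ L₂, L₁ ≠ [] → L₂ ≠ [] → L₁.length ≤ 2 ^ s → L₂.length ≤ 2 ^ s →
      P s L₁ → P s L₂ → P (s + 1) (L₁ ++ L₂))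
    (s : ℕ) (L : List α) (hL : L.length ≤ 2 ^ s) : P s L := by
  induction s generalizing L with
  | zero =>
    match L, hL with
    | [], _ => exact nil 0
    | [a], _ => exact singleton 0 a
    | a :: b :: L, hL => simp at hL
  | succ s ih =>
    match L, hL with
    | [], _ => exact nil _
    | [a], _ => exact singleton _ a
    | a :: b :: L, hL =>
      rw [← List.take_append_drop ((a :: b :: L).length / 2) (a :: b :: L)]
      rw [pow_succ] at hL
      simp only [List.length_cons] at hL
      have h₁ : (List.take ((a :: b :: L).length / 2) (a :: b :: L)).length ≤ 2 ^ s := by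
        simp only [List.length_take, List.length_cons]
        omega
      have h₂ : (List.drop ((a :: b :: L).length / 2) (a :: b :: L)).length ≤ 2 ^ s := by
        simp only [List.length_drop, List.length_cons]
        omega
      refine append s _ _ ?_ ?_ h₁ h₂ (ih _ h₁) (ih _ h₂)
      · rw [← List.length_pos_iff, List.length_take]
        simp only [List.length_cons]
        omega
      · rw [← List.length_pos_iff, List.length_drop]
        simp only [List.length_cons]
        omega

theorem list_prod_monic {L : List K[X]} (hL : ∀ g ∈ L, g.Monic) :
    L.prod.Monic ∧ L.prod.natDegree = (L.map natDegree).sum := by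
  induction L with
  | nil => simp
  | cons g L ih =>
    obtain ⟨h1, h2⟩ := ih fun g hg => hL g (List.mem_cons_of_mem _ hg)
    have h3 := hL g List.mem_cons_self
    rw [List.prod_cons, List.map_cons, List.sum_cons, ← h2]
    exact ⟨h3.mul h1, h3.natDegree_mul h1⟩

theorem natDegree_sum_pos {L : List K[X]} (hL : L ≠ []) (h : ∀ g ∈ L, 0 < g.natDegree) :
    0 < (L.map natDegree).sum := by
  obtain ⟨g, L', rfl⟩ := List.exists_cons_of_ne_nil hL
  have := h g List.mem_cons_self
  simp only [List.map_cons, List.sum_cons]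
  omega

theorem degree_lt_of_natDegree_lt {f : K[X]} {n : ℕ} (h : f.natDegree < n) : f.degree < n :=
  degree_le_natDegree.trans_lt (by exact_mod_cast h)

/-- The product of a list of polynomials, multiplied along a balanced tree. -/
theorem MulBound.computes_prod (hM : MulBound K N μ) (s : ℕ) (L : List K[X])
    (hlen : L.length ≤ 2 ^ s) (hL : ∀ g ∈ L, g.Monic ∧ 0 < g.natDegree)
    (hN : (L.map natDegree).sum ≤ N) :
    Computes (listCoeffs L) (s * (μ * (L.map natDegree).sum)) (coeffSet L.prod) := by
  refine List.balanced_induction (P := fun s L => (∀ g ∈ L, g.Monic ∧ 0 < g.natDegree) →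
    (L.map natDegree).sum ≤ N →
    Computes (listCoeffs L) (s * (μ * (L.map natDegree).sum)) (coeffSet L.prod))
    (fun s _ _ => ?_) (fun s g _ _ => ?_) (fun s L₁ L₂ h₁ h₂ _ _ ih₁ ih₂ hL hN => ?_) s L hlen hL hN
  · refine .subset ?_
    rw [List.prod_nil, ← C_1]
    refine (coeffSet_C_subset _).trans ?_
    simp [Set.subset_def]
  · rw [List.prod_singleton]
    exact .of_subset (coeffSet_subset_listCoeffs List.mem_cons_self)
  · rw [List.map_append, List.sum_append] at hN ⊢
    have hL₁ := fun g hg => hL g (List.mem_append_left L₂ hg)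
    have hL₂ := fun g hg => hL g (List.mem_append_right L₁ hg)
    have e₁ := (list_prod_monic fun g hg => (hL₁ g hg).1).2
    have e₂ := (list_prod_monic fun g hg => (hL₂ g hg).1).2
    have p₁ := natDegree_sum_pos h₁ fun g hg => (hL₁ g hg).2
    have p₂ := natDegree_sum_pos h₂ fun g hg => (hL₂ g hg).2
    rw [listCoeffs_append, List.prod_append]
    have c := (((ih₁ hL₁ (by omega)).mono_left (S' := listCoeffs L₁ ∪ listCoeffs L₂)
      (Set.subset_union_left.trans Set.subset_union_left)).union
      ((ih₂ hL₂ (by omega)).mono_left (S' := listCoeffs L₁ ∪ listCoeffs L₂)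
      (Set.subset_union_right.trans Set.subset_union_left))).trans
      (hM.computes_mul (f := L₁.prod) (g := L₂.prod) hN
        (degree_lt_of_natDegree_lt (by omega)) (degree_lt_of_natDegree_lt (by omega))
        (fun x hx => Or.inl (Or.inr (Or.inl hx))) (fun x hx => Or.inl (Or.inr (Or.inr hx))))
    exact c.mono_cost (le_of_eq (by ring))

theorem modByMonic_modByMonic_of_dvd {f g h : K[X]} (hh : h.Monic) (hgh : h ∣ g) :
    (f %ₘ g) %ₘ h = f %ₘ h :=
  modByMonic_eq_of_dvd_sub hh (hgh.trans (dvd_modByMonic_sub f g))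

/-- Composition of three stages that need `A`, then `F` and the result `P` of the first stage, then
`A` again and the result `R` of the second stage. -/
theorem Computes.three_stages {A B F P R V : Set K} {x y z : ℕ} (h₁ : Computes A x P)
    (h₂ : Computes (F ∪ P) y R) (h₃ : Computes (R ∪ A) z V) (hA : A ⊆ B) :
    Computes (F ∪ B) (x + (y + z)) V := by
  have h₄ := (h₁.mono_left (S' := F ∪ B) (fun x hx => Or.inl (Or.inr (hA hx)))).trans_union
    (h₂.mono_left (Set.union_subset (fun x hx => Or.inl (Or.inl (Or.inl hx)))
      (fun x hx => Or.inl (Or.inr hx))))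
  exact (h₄.trans' h₃ (Set.union_subset (fun x hx => Or.inl (Or.inr (Or.inr hx)))
    (fun x hx => Or.inl (Or.inl (Or.inr (hA hx)))))).mono_cost (by omega)

/-- Remainders of one polynomial modulo all polynomials of a list, by reduction modulo the products
of the two halves of the list. -/
theorem MulBound.computes_remainders_of_lt [Nontrivial K] (hM : MulBound K N μ) (s : ℕ)
    (L : List K[X]) (hlen : L.length ≤ 2 ^ s) (hL : ∀ g ∈ L, g.Monic ∧ 0 < g.natDegree)
    (hN : (L.map natDegree).sum ≤ N) (f : K[X]) (hf : f.degree < (L.map natDegree).sum) :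
    Computes (coeffSet f ∪ listCoeffs L) (s * (s + 38) * (μ * (L.map natDegree).sum))
      (listCoeffs (L.map (f %ₘ ·))) := by
  have hμ := hM.1
  refine List.balanced_induction (P := fun s L =>
    (∀ g ∈ L, g.Monic ∧ 0 < g.natDegree) → (L.map natDegree).sum ≤ N →
    ∀ f : K[X], f.degree < (L.map natDegree).sum →
    Computes (coeffSet f ∪ listCoeffs L) (s * (s + 38) * (μ * (L.map natDegree).sum))
      (listCoeffs (L.map (f %ₘ ·))))
    (fun s _ _ f _ => ?_) (fun s g hL _ f hf => ?_)
    (fun s L₁ L₂ h₁ h₂ len₁ len₂ ih₁ ih₂ hL hN f hf => ?_) s L hlen hL hN f hf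
  · exact .subset (by simp [listCoeffs])
  · have h := (hL g List.mem_cons_self).1
    have h1 : f %ₘ g = f := (modByMonic_eq_self_iff h).2 (by
      rw [degree_eq_natDegree h.ne_zero]
      simpa using hf)
    refine .of_subset ?_
    rintro x ⟨u, hu, hx⟩
    simp only [List.map_cons, List.map_nil, List.mem_singleton, h1] at hu
    exact Or.inl (hu ▸ hx)
  · rw [List.map_append, List.sum_append] at hN hf ⊢
    have hL₁ := fun g hg => hL g (List.mem_append_left L₂ hg)
    have hL₂ := fun g hg => hL g (List.mem_append_right L₁ hg)
    obtain ⟨m₁, e₁⟩ := list_prod_monic fun g hg => (hL₁ g hg).1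
    obtain ⟨m₂, e₂⟩ := list_prod_monic fun g hg => (hL₂ g hg).1
    have p₁ := natDegree_sum_pos h₁ fun g hg => (hL₁ g hg).2
    have c₁ := hM.computes_prod s L₁ len₁ hL₁ (by omega)
    have c₂ := hM.computes_prod s L₂ len₂ hL₂ (by omega)
    have d₁ : (f %ₘ L₁.prod).degree < (L₁.map natDegree).sum := by
      rw [← e₁, ← degree_eq_natDegree m₁.ne_zero]
      exact degree_modByMonic_lt f m₁
    have d₂ : (f %ₘ L₂.prod).degree < (L₂.map natDegree).sum := by
      rw [← e₂, ← degree_eq_natDegree m₂.ne_zero]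
      exact degree_modByMonic_lt f m₂
    set D₁ := (L₁.map natDegree).sum
    set D₂ := (L₂.map natDegree).sum
    have hfn : f.natDegree ≤ D₁ + D₂ - 1 := by
      rw [natDegree_le_iff_coeff_eq_zero]
      intro i hi
      exact (degree_lt_iff_coeff_zero f _).1 hf i (by omega)
    have r₁ := hM.computes_modByMonic (n := D₁ + D₂ - 1) (by omega) hfn m₁
    have r₂ := hM.computes_modByMonic (n := D₁ + D₂ - 1) (by omega) hfn m₂
    rw [show D₁ + D₂ - 1 + 1 = D₁ + D₂ by omega] at r₁ r₂
    have i₁ := ih₁ hL₁ (by omega) _ d₁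
    have i₂ := ih₂ hL₂ (by omega) _ d₂
    have q₁ : (L₁.map (f %ₘ L₁.prod %ₘ ·)) = L₁.map (f %ₘ ·) :=
      List.map_congr_left fun g hg =>
        modByMonic_modByMonic_of_dvd (hL₁ g hg).1 (List.dvd_prod hg)
    have q₂ : (L₂.map (f %ₘ L₂.prod %ₘ ·)) = L₂.map (f %ₘ ·) :=
      List.map_congr_left fun g hg =>
        modByMonic_modByMonic_of_dvd (hL₂ g hg).1 (List.dvd_prod hg)
    rw [q₁] at i₁
    rw [q₂] at i₂
    rw [List.map_append, listCoeffs_append, listCoeffs_append]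
    refine ((Computes.three_stages c₁ r₁ i₁ Set.subset_union_left).union
      (Computes.three_stages c₂ r₂ i₂ Set.subset_union_right)).mono_cost ?_
    nlinarith [Nat.zero_le (s * (μ * (D₁ + D₂)))]

/-- Remainders of one polynomial modulo several ones: it is first reduced modulo their product. -/
theorem MulBound.computes_remainders [Nontrivial K] (hM : MulBound K N μ) (s : ℕ)
    (L : List K[X]) (hlen : L.length ≤ 2 ^ s) (hL : ∀ g ∈ L, g.Monic ∧ 0 < g.natDegree) {n : ℕ}
    (hn : n + 1 ≤ N) (hN : (L.map natDegree).sum ≤ N) {f : K[X]} (hf : f.natDegree ≤ n) :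
    Computes (coeffSet f ∪ listCoeffs L)
      ((s ^ 2 + 39 * s + 19) * (μ * (n + (L.map natDegree).sum)))
      (listCoeffs (L.map (f %ₘ ·))) := by
  rcases eq_or_ne L [] with rfl | h
  · exact .subset (by simp [listCoeffs])
  obtain ⟨m, e⟩ := list_prod_monic fun g hg => (hL g hg).1
  have p := natDegree_sum_pos h fun g hg => (hL g hg).2
  have d : (f %ₘ L.prod).degree < (L.map natDegree).sum := by
    rw [← e, ← degree_eq_natDegree m.ne_zero]
    exact degree_modByMonic_lt f m
  have c₁ := hM.computes_prod s L hlen hL hN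
  have c₂ := hM.computes_modByMonic hn hf m
  have c₃ := hM.computes_remainders_of_lt s L hlen hL hN _ d
  have q : (L.map (f %ₘ L.prod %ₘ ·)) = L.map (f %ₘ ·) :=
    List.map_congr_left fun g hg => modByMonic_modByMonic_of_dvd (hL g hg).1 (List.dvd_prod hg)
  rw [q] at c₃
  refine (Computes.three_stages c₁ c₂ c₃ subset_rfl).mono_cost ?_
  set D := (L.map natDegree).sum
  have h1 : μ * D ≤ μ * (n + D) := Nat.mul_le_mul_left _ (by omega)
  have h2 : μ * (n + 1) ≤ μ * (n + D) := Nat.mul_le_mul_left _ (by omega)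
  calc s * (μ * D) + (19 * μ * (n + 1) + s * (s + 38) * (μ * D))
      = (s ^ 2 + 39 * s) * (μ * D) + 19 * (μ * (n + 1)) := by ring
    _ ≤ (s ^ 2 + 39 * s) * (μ * (n + D)) + 19 * (μ * (n + D)) :=
        Nat.add_le_add (Nat.mul_le_mul_left _ h1) (Nat.mul_le_mul_left _ h2)
    _ = (s ^ 2 + 39 * s + 19) * (μ * (n + D)) := by ring

end FastArithmetic

/-! ### The four lines of the algorithm -/

section Lines

variable {K : Type*} [CommRing K]

theorem coeff_polyOfCoeffs {m : ℕ} (v : Fin m → K) (i : ℕ) :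
    (polyOfCoeffs v).coeff i = if h : i < m then v ⟨i, h⟩ else 0 := by
  simp only [polyOfCoeffs, finsetSum_coeff, coeff_C_mul, coeff_X_pow, mul_ite, mul_one, mul_zero]
  split_ifs with h
  · rw [Finset.sum_eq_single ⟨i, h⟩]
    · simp
    · intro j _ hj
      rw [if_neg fun hij => hj (Fin.ext hij.symm)]
    · simp
  · refine Finset.sum_eq_zero fun j _ => if_neg ?_
    have := j.2
    omega

theorem degree_polyOfCoeffs_lt {m : ℕ} (v : Fin m → K) : (polyOfCoeffs v).degree < m := by
  rw [degree_lt_iff_coeff_zero]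
  intro i hi
  rw [coeff_polyOfCoeffs, dif_neg (by omega)]

theorem polyOfCoeffs_coeff {m : ℕ} {f : K[X]} (hf : f.degree < m) :
    polyOfCoeffs (fun j : Fin m => f.coeff j) = f := by
  ext i
  rw [coeff_polyOfCoeffs]
  split_ifs with h
  · rfl
  · exact ((degree_lt_iff_coeff_zero f m).1 hf i (by omega)).symm

theorem map_polyOfCoeffs {R : Type*} [CommRing R] (φ : K →+* R) {m : ℕ} (v : Fin m → K) :
    (polyOfCoeffs v).map φ = polyOfCoeffs (fun j => φ (v j)) := by
  simp [polyOfCoeffs, Polynomial.map_sum]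

theorem coeffSet_polyOfCoeffs_subset {m : ℕ} {v : Fin m → K} {S : Set K} (h : ∀ j, v j ∈ S) :
    coeffSet (polyOfCoeffs v) ⊆ S ∪ {0, 1} := by
  rintro _ ⟨i, rfl⟩
  rw [coeff_polyOfCoeffs]
  split_ifs
  · exact Or.inl (h _)
  · exact Or.inr (by simp)

/-- The monic polynomial of degree `m` with lower coefficients `v`. -/
noncomputable def monicOfCoeffs {m : ℕ} (v : Fin m → K) : K[X] := X ^ m + polyOfCoeffs v

theorem monic_monicOfCoeffs {m : ℕ} (v : Fin m → K) : (monicOfCoeffs v).Monic :=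
  monic_X_pow_add (degree_polyOfCoeffs_lt v)

theorem natDegree_monicOfCoeffs [Nontrivial K] {m : ℕ} (v : Fin m → K) :
    (monicOfCoeffs v).natDegree = m :=
  natDegree_eq_of_degree_eq_some (by
    rw [monicOfCoeffs, degree_add_eq_left_of_degree_lt, degree_X_pow]
    rw [degree_X_pow]
    exact degree_polyOfCoeffs_lt v)

theorem map_monicOfCoeffs {R : Type*} [CommRing R] (φ : K →+* R) {m : ℕ} (v : Fin m → K) :
    (monicOfCoeffs v).map φ = monicOfCoeffs (fun j => φ (v j)) := by
  simp [monicOfCoeffs, map_polyOfCoeffs]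

theorem monicOfCoeffs_coeff {m : ℕ} {f : K[X]} (hf : f.Monic) (hm : f.natDegree = m) :
    monicOfCoeffs (fun j : Fin m => f.coeff j) = f := by
  subst hm
  conv_rhs => rw [hf.as_sum]
  rw [monicOfCoeffs, polyOfCoeffs, Finset.sum_range]

theorem coeffSet_monicOfCoeffs_subset {m : ℕ} {v : Fin m → K} {S : Set K} (h : ∀ j, v j ∈ S) :
    coeffSet (monicOfCoeffs v) ⊆ S ∪ {0, 1} := by
  rintro _ ⟨i, rfl⟩
  rw [monicOfCoeffs, coeff_add, coeff_X_pow, coeff_polyOfCoeffs]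
  split_ifs
  · omega
  · exact Or.inr (by simp)
  · rw [zero_add]
    exact Or.inl (h _)
  · exact Or.inr (by simp)

variable {l : ℕ} {δ : Fin l → ℕ} {S : Set K}

theorem Computes.sigma {m : Fin l → ℕ} {c : Fin l → ℕ} (T : (i : Fin l) × Fin (m i) → K)
    (h : ∀ i, Computes S (c i) (Set.range fun j => T ⟨i, j⟩)) :
    Computes S (∑ i, c i) (Set.range T) := by
  refine (Computes.iUnion h).mono_right ?_
  rintro _ ⟨⟨i, j⟩, rfl⟩
  exact Or.inl (Set.mem_iUnion.2 ⟨i, j, rfl⟩)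

/-- The scaled coefficients `r ^ (δ - j) * a j` for `j ≤ δ`; the leading one is not touched. -/
theorem computes_scaledModulus (a : CoeffIndex δ → K) (r : Fin l → K) (ha : ∀ s, a s ∈ S)
    (hr : ∀ i, r i ∈ S) :
    Computes S (2 * ∑ i, δ i)
      (Set.range fun s : CoeffIndex δ => r s.1 ^ (δ s.1 - s.2) * a s) := by
  rw [Finset.mul_sum]
  refine Computes.sigma _ fun i => ?_
  have c₁ := Computes.powers (hr i) (δ i)
  have c₂ := c₁.trans (Computes.iUnion (fun j : Fin (δ i) => Computes.mul
    (a := r i ^ (δ i - j)) (b := a ⟨i, j.castSucc⟩) (Or.inl (Or.inr (Set.mem_iUnion₂.2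
      ⟨δ i - j, by simp, rfl⟩))) (Or.inl (Or.inl (ha _)))))
  have c₃ := (Computes.refl S (n := 0)).union c₂
  refine (c₃.mono_cost (by simp; omega)).mono_right ?_
  rintro _ ⟨j, rfl⟩
  rcases Fin.eq_castSucc_or_eq_last j with ⟨j, rfl⟩ | rfl
  · exact Or.inl (Or.inr (Set.mem_iUnion.2 ⟨j, rfl⟩))
  · refine Or.inl (Or.inl ?_)
    simp [ha]

variable {N μ s : ℕ}

/-- The Taylor shifts by `-α i`; constant polynomials are not touched. -/
theorem MulBound.computes_shiftedModulus (hM : MulBound K (N + 1) μ) (hs : N + 1 ≤ 2 ^ s)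
    (hs1 : 1 ≤ s) (hN : ∑ i, δ i ≤ N) (b : CoeffIndex δ → K) (α : Fin l → K) (hb : ∀ s, b s ∈ S)
    (hα : ∀ i, α i ∈ S) :
    Computes S (11 * s * μ * ∑ i, δ i) (Set.range fun t : CoeffIndex δ =>
      (taylor (-α t.1) (polyOfCoeffs fun j => b ⟨t.1, j⟩)).coeff t.2) := by
  have hμ := hM.1
  rw [Finset.mul_sum]
  refine Computes.sigma _ fun i => ?_
  have hi : δ i ≤ N := (Finset.single_le_sum (f := δ) (fun _ _ => Nat.zero_le _)
    (Finset.mem_univ i)).trans hN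
  have hS := coeffSet_polyOfCoeffs_subset (S := S) (v := fun j => b ⟨i, j⟩) fun j => hb _
  have hd := degree_polyOfCoeffs_lt fun j => b ⟨i, j⟩
  rcases Nat.eq_zero_or_pos (δ i) with h0 | h0
  · have h1 := taylor_of_degree_lt_one (-α i) (degree_lt_of_lt_of_le hd (by omega))
    refine .subset ?_
    rintro _ ⟨j, rfl⟩
    rw [← h1] at hS
    exact hS ⟨_, rfl⟩
  · have c₁ : Computes S 1 {-α i} := by
      rw [← zero_sub]
      exact Computes.sub (Or.inr (by simp)) (Or.inl (hα i))
    have c₂ := c₁.trans ((hM.computes_taylor (-α i) s (δ i + 1) (by omega) (by omega)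
      hd).mono_left (S' := S ∪ {-α i}) (Set.union_subset (hS.trans (Set.union_subset_union_left _
        Set.subset_union_left)) (Set.subset_union_right.trans Set.subset_union_left)))
    refine (c₂.mono_cost ?_).mono_right ?_
    · have h1 : s * (5 * μ * (δ i + 1)) ≤ s * (5 * μ * (2 * δ i)) :=
        Nat.mul_le_mul_left _ (Nat.mul_le_mul_left _ (by omega))
      have h2 : 1 ≤ s * μ * δ i := Nat.mul_pos (Nat.mul_pos hs1 hμ) h0
      calc 1 + s * (5 * μ * (δ i + 1)) ≤ s * μ * δ i + s * (5 * μ * (2 * δ i)) :=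
            Nat.add_le_add h2 h1
        _ = 11 * s * μ * δ i := by ring
    · rintro _ ⟨j, rfl⟩
      exact Or.inl ⟨_, rfl⟩

/-- The remainders modulo the moduli of positive degree; the others contribute no output. -/
theorem MulBound.computes_shiftedModulusRem [Nontrivial K] (hM : MulBound K (N + 1) μ)
    (hs : N + 1 ≤ 2 ^ s) {n : ℕ} (hN : n + ∑ i, δ i ≤ N) (q : Fin (n + 1) → K)
    (b : CoeffIndex δ → K) (hq : ∀ j, q j ∈ S) (hb : ∀ s, b s ∈ S) :
    Computes S ((s ^ 2 + 39 * s + 19) * (μ * (n + ∑ i, δ i))) (Set.range fun t : RemIndex δ =>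
      (polyOfCoeffs q %ₘ monicOfCoeffs fun j : Fin (δ t.1) => b ⟨t.1, j.castSucc⟩).coeff t.2) := by
  classical
  let G : Fin l → K[X] := fun i => monicOfCoeffs fun j : Fin (δ i) => b ⟨i, j.castSucc⟩
  let I : Finset (Fin l) := Finset.univ.filter fun i => 0 < δ i
  let L : List K[X] := I.toList.map G
  have hsum : (L.map natDegree).sum = ∑ i, δ i := by
    simp only [L, List.map_map]
    rw [Finset.sum_map_toList]
    simp only [Function.comp_apply, G, natDegree_monicOfCoeffs]
    exact Finset.sum_filter_of_ne fun i _ hi => Nat.pos_of_ne_zero hi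
  have hlen : L.length ≤ ∑ i, δ i := by
    simp only [L, List.length_map, Finset.length_toList]
    rw [Finset.card_eq_sum_ones]
    calc ∑ i ∈ I, 1 ≤ ∑ i ∈ I, δ i :=
          Finset.sum_le_sum fun i hi => (Finset.mem_filter.1 hi).2
      _ ≤ ∑ i, δ i := Finset.sum_le_sum_of_subset (Finset.subset_univ _)
  have hf : (polyOfCoeffs q).natDegree ≤ n := by
    rw [natDegree_le_iff_coeff_eq_zero]
    intro i hi
    rw [coeff_polyOfCoeffs, dif_neg (by omega)]
  have c := hM.computes_remainders s L (by omega) (by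
    intro g hg
    obtain ⟨i, hi, rfl⟩ := List.mem_map.1 hg
    refine ⟨monic_monicOfCoeffs _, ?_⟩
    rw [natDegree_monicOfCoeffs]
    exact (Finset.mem_filter.1 (Finset.mem_toList.1 hi)).2) (n := n) (by omega) (by omega) hf
  rw [hsum] at c
  refine (c.mono_left (S' := S) ?_).mono_right ?_
  · refine Set.union_subset (coeffSet_polyOfCoeffs_subset hq) ?_
    rintro x ⟨g, hg, hx⟩
    obtain ⟨i, hi, rfl⟩ := List.mem_map.1 hg
    exact coeffSet_monicOfCoeffs_subset (fun j => hb _) hx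
  · rintro _ ⟨⟨i, j⟩, rfl⟩
    refine Or.inl ⟨polyOfCoeffs q %ₘ G i, List.mem_map.2 ⟨G i, List.mem_map.2 ⟨i, ?_, rfl⟩, rfl⟩,
      _, rfl⟩
    exact Finset.mem_toList.2 (Finset.mem_filter.2 ⟨Finset.mem_univ _, j.pos⟩)

/-- The substitution of `α i + r i * y` as a Taylor shift followed by a scaling. -/
theorem MulBound.computes_shiftedRem (hM : MulBound K (N + 1) μ) (hs : N + 1 ≤ 2 ^ s)
    (hN : ∑ i, δ i ≤ N) (v : RemIndex δ → K) (α r : Fin l → K) (hv : ∀ s, v s ∈ S)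
    (hα : ∀ i, α i ∈ S) (hr : ∀ i, r i ∈ S) :
    Computes S ((5 * s * μ + 2) * ∑ i, δ i) (Set.range fun t : RemIndex δ =>
      (taylor (α t.1) (polyOfCoeffs fun j => v ⟨t.1, j⟩)).coeff t.2 * r t.1 ^ (t.2 : ℕ)) := by
  rw [Finset.mul_sum]
  refine Computes.sigma _ fun i => ?_
  have hi : δ i ≤ N := (Finset.single_le_sum (f := δ) (fun _ _ => Nat.zero_le _)
    (Finset.mem_univ i)).trans hN
  have hS := coeffSet_polyOfCoeffs_subset (S := S) (v := fun j => v ⟨i, j⟩) fun j => hv _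
  have hd := degree_polyOfCoeffs_lt fun j => v ⟨i, j⟩
  have c₁ := ((hM.computes_taylor (α i) s (δ i) (by omega) (by omega) hd).mono_left (S' := S)
    (Set.union_subset hS (Set.singleton_subset_iff.2 (Or.inl (hα i))))).union
    (Computes.powers (hr i) (δ i))
  have c₂ := c₁.trans (Computes.iUnion (fun j : Fin (δ i) => Computes.mul
    (a := (taylor (α i) (polyOfCoeffs fun j => v ⟨i, j⟩)).coeff j) (b := r i ^ (j : ℕ))
    (Or.inl (Or.inr (Or.inl ⟨_, rfl⟩)))
    (Or.inl (Or.inr (Or.inr (Set.mem_iUnion₂.2 ⟨j, by simp, rfl⟩))))))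
  refine (c₂.mono_cost (le_of_eq ?_)).mono_right ?_
  · simp
    ring
  · rintro _ ⟨j, rfl⟩
    exact Or.inl (Set.mem_iUnion.2 ⟨j, rfl⟩)

end Lines

/-! ### The algorithm in terms of Taylor shifts and scaled roots -/

section Correctness

variable {R : Type*} [CommRing R]

theorem scaledModulus_eq_scaleRoots (A : R[X]) (r : R) : scaledModulus A r = A.scaleRoots r := by
  ext j
  rw [coeff_scaleRoots]
  simp only [scaledModulus, finsetSum_coeff, coeff_C_mul, coeff_X_pow, mul_ite, mul_one, mul_zero,
    Finset.sum_ite_eq, Finset.mem_range]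
  split_ifs with h
  · exact mul_comm _ _
  · rw [coeff_eq_zero_of_natDegree_lt (by omega), zero_mul]

theorem shiftedModulus_eq_taylor (A : R[X]) (α r : R) :
    shiftedModulus A α r = taylor (-α) (A.scaleRoots r) := by
  rw [shiftedModulus, scaledModulus_eq_scaleRoots, taylor_apply, C_neg, sub_eq_add_neg]

theorem natDegree_shiftedModulus (A : R[X]) (α r : R) :
    (shiftedModulus A α r).natDegree = A.natDegree := by
  rw [shiftedModulus_eq_taylor, natDegree_taylor, natDegree_scaleRoots]

theorem monic_shiftedModulus {A : R[X]} (hA : A.Monic) (α r : R) :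
    (shiftedModulus A α r).Monic := by
  rw [shiftedModulus_eq_taylor, Monic, leadingCoeff_taylor]
  exact (monic_scaleRoots_iff r).2 hA

theorem comp_affine_eq (f : R[X]) (α r : R) :
    f.comp (C α + C r * X) = (taylor α f).comp (C r * X) := by
  rw [taylor_apply, comp_assoc, add_comp, X_comp, C_comp, add_comm]

theorem coeff_comp_affine (f : R[X]) (α r : R) (j : ℕ) :
    (f.comp (C α + C r * X)).coeff j = (taylor α f).coeff j * r ^ j := by
  rw [comp_affine_eq, comp_C_mul_X_coeff]

theorem degree_comp_affine_lt {f : R[X]} {n : ℕ} (hf : f.degree < n) (α r : R) :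
    (f.comp (C α + C r * X)).degree < n := by
  rw [degree_lt_iff_coeff_zero]
  intro j hj
  rw [← degree_taylor f α] at hf
  rw [coeff_comp_affine, (degree_lt_iff_coeff_zero _ n).1 hf j hj, zero_mul]

/-- Substituting `α + r * y` into the modified modulus gives a multiple of the given one. -/
theorem shiftedModulus_comp_affine (A : R[X]) (α r : R) :
    (shiftedModulus A α r).comp (C α + C r * X) = C (r ^ A.natDegree) * A := by
  ext j
  rw [coeff_comp_affine, shiftedModulus_eq_taylor, taylor_taylor, add_neg_cancel, taylor_zero,
    coeff_scaleRoots, coeff_C_mul]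
  rcases le_or_gt j A.natDegree with h | h
  · rw [mul_assoc, ← pow_add, Nat.sub_add_cancel h, mul_comm]
  · rw [coeff_eq_zero_of_natDegree_lt h, zero_mul, zero_mul, mul_zero]

theorem degree_shiftedModulusRem_lt [Nontrivial R] (Q : R[X]) {A : R[X]} (hA : A.Monic) (α r : R) :
    (shiftedModulusRem Q A α r).degree < A.natDegree := by
  have h := degree_modByMonic_lt Q (monic_shiftedModulus hA α r)
  rwa [degree_eq_natDegree (monic_shiftedModulus hA α r).ne_zero, natDegree_shiftedModulus] at h

theorem shiftedRem_eq {l : ℕ} (Q : R[X]) (A : Fin l → R[X]) (α r : Fin l → R) (i : Fin l)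
    (hA : (A i).Monic) :
    shiftedRem Q A α r i = (Q.comp (C (α i) + C (r i) * X)) %ₘ A i := by
  nontriviality R
  have h := modByMonic_add_div Q (shiftedModulus (A i) (α i) (r i))
  refine ((div_modByMonic_unique (C (r i ^ (A i).natDegree) *
    (Q /ₘ shiftedModulus (A i) (α i) (r i)).comp (C (α i) + C (r i) * X)) _ hA ⟨?_, ?_⟩).2).symm
  · conv_rhs => rw [← h, add_comp, mul_comp, shiftedModulus_comp_affine]
    rw [shiftedRem, shiftedModulusRem]
    ring
  · rw [degree_eq_natDegree hA.ne_zero]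
    exact degree_comp_affine_lt (degree_shiftedModulusRem_lt Q hA _ _) _ _

end Correctness

/-! ### Implementation and total cost -/

/-- Over every commutative ring, the four programs compute the coefficients that the corresponding
lines of the algorithm ask for. -/
structure ShiftedRemProgram.Correct.{u} {n l : ℕ} {δ : Fin l → ℕ} (P : ShiftedRemProgram n δ) :
    Prop where
  line1 : ∀ (R : Type u) [CommRing R] (a : CoeffIndex δ → R) (r : Fin l → R) (t : CoeffIndex δ),
    P.line1.eval (Sum.elim a r) t = r t.1 ^ (δ t.1 - t.2) * a t
  line2 : ∀ (R : Type u) [CommRing R] (b : CoeffIndex δ → R) (α : Fin l → R) (t : CoeffIndex δ),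
    P.line2.eval (Sum.elim b α) t =
      (taylor (-α t.1) (polyOfCoeffs fun j => b ⟨t.1, j⟩)).coeff t.2
  line3 : ∀ (R : Type u) [CommRing R] (q : Fin (n + 1) → R) (b : CoeffIndex δ → R)
    (t : RemIndex δ), P.line3.eval (Sum.elim q b) t =
      (polyOfCoeffs q %ₘ monicOfCoeffs fun j : Fin (δ t.1) => b ⟨t.1, j.castSucc⟩).coeff t.2
  line4 : ∀ (R : Type u) [CommRing R] (v : RemIndex δ → R) (α r : Fin l → R) (t : RemIndex δ),
    P.line4.eval (Sum.elim v (Sum.elim α r)) t =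
      (taylor (α t.1) (polyOfCoeffs fun j => v ⟨t.1, j⟩)).coeff t.2 * r t.1 ^ (t.2 : ℕ)

theorem ShiftedRemProgram.Correct.implements.{u} {R : Type u} [CommRing R] {l : ℕ} {Q : R[X]}
    {A : Fin l → R[X]} {α r : Fin l → R}
    {P : ShiftedRemProgram Q.natDegree (fun i => (A i).natDegree)}
    (h : ShiftedRemProgram.Correct.{u} P)
    (hA : ∀ i, (A i).Monic) : P.Implements Q A α r := by
  have hlt : ∀ {f : R[X]} {n : ℕ}, f.natDegree = n → f.degree < (n + 1 : ℕ) := fun {f n} hf =>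
    degree_lt_of_natDegree_lt (by omega)
  have d₁ : ∀ i, (scaledModulus (A i) (r i)).degree < ((A i).natDegree + 1 : ℕ) := fun i =>
    hlt (by rw [scaledModulus_eq_scaleRoots, natDegree_scaleRoots])
  have d₂ : ∀ i, (shiftedModulus (A i) (α i) (r i)).degree < ((A i).natDegree + 1 : ℕ) := fun i =>
    hlt (natDegree_shiftedModulus _ _ _)
  have h₁ : P.result1 (fun s => (A s.1).coeff s.2) r =
      fun t => (scaledModulus (A t.1) (r t.1)).coeff t.2 := by
    funext t
    rw [ShiftedRemProgram.result1, h.line1, scaledModulus_eq_scaleRoots, coeff_scaleRoots, mul_comm]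
  have h₂ : P.result2 (fun s => (A s.1).coeff s.2) α r =
      fun t => (shiftedModulus (A t.1) (α t.1) (r t.1)).coeff t.2 := by
    funext t
    rw [ShiftedRemProgram.result2, h.line2, h₁]
    simp only
    rw [polyOfCoeffs_coeff (d₁ t.1), scaledModulus_eq_scaleRoots, ← shiftedModulus_eq_taylor]
  have h₃ : P.result3 (fun t => Q.coeff t) (fun s => (A s.1).coeff s.2) α r =
      fun t => (shiftedModulusRem Q (A t.1) (α t.1) (r t.1)).coeff t.2 := by
    funext t
    rw [ShiftedRemProgram.result3, h.line3, h₂, polyOfCoeffs_coeff (hlt rfl)]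
    simp only [Fin.val_castSucc]
    rw [monicOfCoeffs_coeff (monic_shiftedModulus (hA t.1) _ _) (natDegree_shiftedModulus _ _ _),
      shiftedModulusRem]
  have d₃ : ∀ i, polyOfCoeffs (fun j : Fin (A i).natDegree =>
      (shiftedModulusRem Q (A i) (α i) (r i)).coeff j) =
      shiftedModulusRem Q (A i) (α i) (r i) := by
    intro i
    nontriviality R
    exact polyOfCoeffs_coeff (degree_shiftedModulusRem_lt Q (hA i) _ _)
  refine ⟨fun i => ?_, fun i => ?_, fun i => ?_, fun i => ?_⟩
  · rw [h₁]
    have hi := polyOfCoeffs_coeff (d₁ i)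
    exact hi
  · rw [h₂]
    have hi := polyOfCoeffs_coeff (d₂ i)
    exact hi
  · rw [h₃]
    exact d₃ i
  · have h₄ : ∀ j, P.result4 (fun t => Q.coeff t) (fun s => (A s.1).coeff s.2) α r ⟨i, j⟩ =
        (shiftedRem Q A α r i).coeff j := by
      intro j
      rw [ShiftedRemProgram.result4, h.line4, h₃]
      simp only
      rw [d₃, ← coeff_comp_affine, shiftedRem]
    nontriviality R
    exact (congrArg polyOfCoeffs (funext h₄)).trans (polyOfCoeffs_coeff
      (degree_comp_affine_lt (degree_shiftedModulusRem_lt Q (hA i) _ _) _ _))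

/-- Programs for the four lines are obtained by running the computations on generic inputs. -/
theorem exists_correct_program.{u} {n l : ℕ} {δ : Fin l → ℕ} {N μ s : ℕ}
    (hM : ∀ (K : Type) [CommRing K], MulBound K (N + 1) μ) (hs : N + 1 ≤ 2 ^ s) (hs1 : 1 ≤ s)
    (hN : n + ∑ i, δ i ≤ N) :
    ∃ P : ShiftedRemProgram n δ, ShiftedRemProgram.Correct.{u} P ∧
      P.cost ≤ 2 * ∑ i, δ i + 11 * s * μ * ∑ i, δ i +
        (s ^ 2 + 39 * s + 19) * (μ * (n + ∑ i, δ i)) + (5 * s * μ + 2) * ∑ i, δ i := by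
  have hN' : ∑ i, δ i ≤ N := by omega
  obtain ⟨P₁, c₁, e₁⟩ := exists_program.{u} _ (computes_scaledModulus (δ := δ)
    (K := MvPolynomial (CoeffIndex δ ⊕ Fin l) ℤ) (S := Set.range MvPolynomial.X)
    (fun t => .X (.inl t)) (fun i => .X (.inr i)) (fun _ => ⟨_, rfl⟩) (fun _ => ⟨_, rfl⟩))
  obtain ⟨P₂, c₂, e₂⟩ := exists_program.{u} _ ((hM _).computes_shiftedModulus hs hs1 hN' (δ := δ)
    (K := MvPolynomial (CoeffIndex δ ⊕ Fin l) ℤ) (S := Set.range MvPolynomial.X)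
    (fun t => .X (.inl t)) (fun i => .X (.inr i)) (fun _ => ⟨_, rfl⟩) (fun _ => ⟨_, rfl⟩))
  obtain ⟨P₃, c₃, e₃⟩ := exists_program.{u} _ ((hM _).computes_shiftedModulusRem hs hN (δ := δ)
    (K := MvPolynomial (Fin (n + 1) ⊕ CoeffIndex δ) ℤ) (S := Set.range MvPolynomial.X)
    (fun t => .X (.inl t)) (fun i => .X (.inr i)) (fun _ => ⟨_, rfl⟩) (fun _ => ⟨_, rfl⟩))
  obtain ⟨P₄, c₄, e₄⟩ := exists_program.{u} _ ((hM _).computes_shiftedRem hs hN' (δ := δ)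
    (K := MvPolynomial (RemIndex δ ⊕ (Fin l ⊕ Fin l)) ℤ) (S := Set.range MvPolynomial.X)
    (fun t => .X (.inl t)) (fun i => .X (.inr (.inl i))) (fun i => .X (.inr (.inr i)))
    (fun _ => ⟨_, rfl⟩) (fun _ => ⟨_, rfl⟩) (fun _ => ⟨_, rfl⟩))
  refine ⟨⟨P₁, P₂, P₃, P₄⟩, ⟨fun R _ a r t => ?_, fun R _ b α t => ?_, fun R _ q b t => ?_,
    fun R _ v α r t => ?_⟩, ?_⟩
  · rw [e₁]
    simp
  · rw [e₂, ← RingHom.coe_coe (MvPolynomial.aeval _), ← coeff_map, map_taylor, map_polyOfCoeffs]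
    simp
  · rw [e₃, ← RingHom.coe_coe (MvPolynomial.aeval _), ← coeff_map,
      map_modByMonic _ (monic_monicOfCoeffs _), map_polyOfCoeffs, map_monicOfCoeffs]
    simp
  · rw [e₄, map_mul, map_pow, ← RingHom.coe_coe (MvPolynomial.aeval _), ← coeff_map, map_taylor,
      map_polyOfCoeffs]
    simp
  · exact Nat.add_le_add (Nat.add_le_add (Nat.add_le_add c₁ c₂) c₃) c₄

/-- The total cost: eight logarithms come from multiplication and two from the depth of the
remainder tree, at each level of which the products are formed again. -/
theorem exists_quasilinear_program.{u} :
    ∃ c : ℕ, ∀ (n l : ℕ) (δ : Fin l → ℕ), ∃ P : ShiftedRemProgram n δ,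
      ShiftedRemProgram.Correct.{u} P ∧
        P.cost ≤ c * (n + ∑ i, δ i) * Nat.log 2 (n + ∑ i, δ i + 2) ^ 10 := by
  obtain ⟨c, hc⟩ := exists_computes_mul.{0}
  refine ⟨137 * (c + 1) * 2 ^ 8, fun n l δ => ?_⟩
  set N := n + ∑ i, δ i with hN
  set L := Nat.log 2 (N + 2) with hL
  have hL1 : 1 ≤ L := Nat.le_log_of_pow_le (by norm_num) (by omega)
  have hlog := Nat.lt_pow_succ_log_self (b := 2) (by norm_num) (N + 2)
  rw [← hL] at hlog
  have hM : ∀ (K : Type) [CommRing K], MulBound K (N + 1) ((c + 1) * (2 * L) ^ 8) := by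
    intro K _
    refine ⟨Nat.mul_pos (by omega) (by positivity), fun m hm f g hf hg => ?_⟩
    refine (hc K m f g hf hg).mono_cost ?_
    have h1 : Nat.log 2 (m + 2) ≤ 2 * L := by
      refine (Nat.lt_succ_iff.1 (Nat.log_lt_of_lt_pow (by omega) ?_) : _ ≤ L + 1).trans (by omega)
      rw [Nat.succ_eq_add_one, pow_succ]
      omega
    calc c * m * Nat.log 2 (m + 2) ^ 8 ≤ c * m * (2 * L) ^ 8 :=
          Nat.mul_le_mul_left _ (Nat.pow_le_pow_left h1 8)
      _ ≤ (c + 1) * m * (2 * L) ^ 8 :=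
          Nat.mul_le_mul_right _ (Nat.mul_le_mul_right _ (Nat.le_succ c))
      _ = (c + 1) * (2 * L) ^ 8 * m := by ring
  obtain ⟨P, hP, hcost⟩ := exists_correct_program.{u} (n := n) (δ := δ) (s := L + 1) hM
    (by omega) (by omega) hN.ge
  refine ⟨P, hP, hcost.trans ?_⟩
  rw [← hN]
  set μ := (c + 1) * (2 * L) ^ 8 with hμ
  have hμ1 : 1 ≤ μ := (hM ℤ).1
  set D := ∑ i, δ i
  have hD : D ≤ N := by omega
  have hNμ : N ≤ μ * N := Nat.le_mul_of_pos_left N hμ1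
  have hDμ : μ * D ≤ μ * N := Nat.mul_le_mul_left _ hD
  calc 2 * D + 11 * (L + 1) * μ * D + ((L + 1) ^ 2 + 39 * (L + 1) + 19) * (μ * N) +
        (5 * (L + 1) * μ + 2) * D
      = 4 * D + 16 * (L + 1) * (μ * D) + ((L + 1) ^ 2 + 39 * (L + 1) + 19) * (μ * N) := by ring
    _ ≤ 4 * (μ * N) + 16 * (L + 1) * (μ * N) + ((L + 1) ^ 2 + 39 * (L + 1) + 19) * (μ * N) := by
        have := Nat.mul_le_mul_left (16 * (L + 1)) hDμ
        omega
    _ = (L ^ 2 + 57 * L + 79) * (μ * N) := by ring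
    _ ≤ (137 * L ^ 2) * (μ * N) := Nat.mul_le_mul_right _ (by nlinarith)
    _ = 137 * (c + 1) * 2 ^ 8 * N * L ^ 10 := by rw [hμ]; ring

theorem proposition3p2 :
    -- correctness
    (∀ (R : Type*) [CommRing R] (l : ℕ) (Q : R[X]) (A : Fin l → R[X]) (α r : Fin l → R),
      (∀ i, (A i).Monic) →
        ∀ i, shiftedRem Q A α r i = (Q.comp (C (α i) + C (r i) * X)) %ₘ A i) ∧
    -- number of ring operations
    (∃ (P : ∀ (n l : ℕ) (δ : Fin l → ℕ), ShiftedRemProgram n δ) (c k : ℕ),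
      ∀ (R : Type*) [CommRing R] (l : ℕ) (Q : R[X]) (A : Fin l → R[X]) (α r : Fin l → R),
        (∀ i, (A i).Monic) →
          (P Q.natDegree l (fun i => (A i).natDegree)).Implements Q A α r ∧
          (P Q.natDegree l (fun i => (A i).natDegree)).cost ≤
            c * (Q.natDegree + (∏ i, A i).natDegree) *
              Nat.log 2 (Q.natDegree + (∏ i, A i).natDegree + 2) ^ k) := by
  refine ⟨fun R _ l Q A α r hA i => shiftedRem_eq Q A α r i (hA i), ?_⟩
  obtain ⟨c, h⟩ := exists_quasilinear_program
  choose P hP hcost using h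
  refine ⟨P, c, 10, fun R _ l Q A α r hA => ⟨(hP _ _ _).implements hA, ?_⟩⟩
  rw [natDegree_prod_of_monic _ _ fun i _ => hA i]
  exact hcost _ _ _
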